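/- Let $d\in\mathbb N$, $\beta\in(0,1)$ and $c_0\ge 1$. For $s>0$ let $\mathbf C^{s}$ be the Hölder–Zygmund space of functions $g:\mathbb R^d\to\mathbb R$ with norm $$\|g\|_{\mathbf C^s}:=\|g\|_\infty+\sup_{h\ne 0}\frac{\|\delta_h^{\lceil s\rceil}g\|_\infty}{|h|^s},\qquad \delta_hg(x):=g(x+h)-g(x).$$ Let $\phi_0$ be a radial $C^\infty$ function on $\mathbb R^d$ with $\phi_0(\xi)=1$ for $|\xi|\le 1$ and $\phi_0(\xi)=0$ for $|\xi|>2$, put $\phi_j(\xi):=\phi_0(2^{-j}\xi)-\phi_0(2^{-(j-1)}\xi)$ for $j\ge1$, and let $\mathcal R_jF:=(\phi_j\hat F)^{\vee}$ be the Littlewood–Paley blocks of a tempered distribution $F$. The Besov space $\mathbf B^s_\infty$ consists of the tempered distributions $F$ with $\|F\|_{\mathbf B^s_\infty}:=\sup_{j\ge0}2^{sj}\|\mathcal R_jF\|_\infty<\infty$; for $s>0$ its elements are continuous functions. For $T>0$ write $\mathbb L^\infty_T(\mathbf B):=L^\infty([0,T];\mathbf B)$ and $\mathbb L^\infty_T:=L^\infty([0,T]\times\mathbb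 R^d)$. Let $a=(a^{ij}):[0,\infty)\times\mathbb R^d\to\mathbb R^{d\times d}$ be measurable, symmetric, and such that for all $t\ge0$ and $x,y,\xi\in\mathbb R^d$ $$c_0^{-1}|\xi|^2\le \sum_{i,j}a^{ij}(t,x)\xi_i\xi_j\le c_0|\xi|^2,\qquad |a(t,x)-a(t,y)|\le c_0|x-y|^\beta .$$ **Theorem (Schauder estimate for the heat equation).** There is a constant $C=C(c_0,\beta,d)$ such that for every such $a$, every $T>0$, and every $u\in\mathbb L^\infty_T(\mathbf B^{2+\beta}_\infty)$ with $\partial_tu\in\mathbb L^\infty_T(\mathbf B^{\beta}_\infty)$ which solves $$\partial_tu=\sum_{i,j}a^{ij}\partial_i\partial_ju+f\quad\text{a.e. on }[0,T]\times\mathbb R^d,\qquad u(0)=0,$$ where $\partial_t u$ is understood in the integrated sense $u(t,x)=u(0,x)+\int_0^t\partial_su(s,x)\,ds$, one has $$\|u\|_{\mathbb L^\infty_T(\mathbf C^{2+\beta})}\le C\Big(\|f\|_{\mathbb L^\infty_T(\mathbf C^\beta)}+\|u\|_{\mathbb L^\infty_T}\Big).$$ -/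

import Mathlib

open MeasureTheory Set
open scoped NNReal ENNReal SchwartzMap FourierTransform ContDiff

noncomputable section

/-- Physical (and frequency) space `ℝ^d` with its Euclidean norm and Lebesgue measure. -/
abbrev RSpace (d : ℕ) : Type := EuclideanSpace ℝ (Fin d)

/-- `[0,T] × ℝ^d` with Lebesgue measure, as a measure on `ℝ × ℝ^d`. -/
def timeSpaceMeasure (d : ℕ) (T : ℝ) : Measure (ℝ × RSpace d) :=
  (volume.restrict (Icc 0 T)).prod volume

/-! ### Littlewood-Paley blocks and Besov spaces -/

/-- A low-frequency cut-off `φ₀`: radial, smooth, equal to `1` on the closed unit ball and to `0`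
off the closed ball of radius `2`. -/
structure LPCutoff (d : ℕ) where
  toFun : RSpace d → ℝ
  smooth : ContDiff ℝ ∞ toFun
  radial : ∀ ξ η, ‖ξ‖ = ‖η‖ → toFun ξ = toFun η
  eq_one : ∀ ξ, ‖ξ‖ ≤ 1 → toFun ξ = 1
  eq_zero : ∀ ξ, 2 < ‖ξ‖ → toFun ξ = 0

namespace LPCutoff

variable {d : ℕ} (φ : LPCutoff d)

/-- The Littlewood-Paley symbols: `φ₀` itself, and `φ_j(ξ) = φ₀(2^{-j} ξ) - φ₀(2^{-(j-1)} ξ)`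
for `j ≥ 1`. -/
def symbol : ℕ → RSpace d → ℝ
  | 0 => φ.toFun
  | j + 1 => fun ξ =>
      φ.toFun (((2 : ℝ)⁻¹ ^ (j + 1)) • ξ) - φ.toFun (((2 : ℝ)⁻¹ ^ j) • ξ)

theorem symbol_smooth (j : ℕ) : ContDiff ℝ ∞ (φ.symbol j) := by
  have h := φ.smooth
  cases j with
  | zero => exact h
  | succ j =>
    exact (h.comp (contDiff_const_smul _)).sub (h.comp (contDiff_const_smul _))

theorem hasCompactSupport_toFun : HasCompactSupport φ.toFun :=
  HasCompactSupport.intro (isCompact_closedBall (0 : RSpace d) 2) fun ξ hξ =>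
    φ.eq_zero ξ (by simpa using hξ)

theorem hasCompactSupport_symbol (j : ℕ) : HasCompactSupport (φ.symbol j) := by
  have h := φ.hasCompactSupport_toFun
  cases j with
  | zero => exact h
  | succ j => exact (h.comp_smul (by positivity)).sub (h.comp_smul (by positivity))

/-- The symbol `φ_j` in the normalisation of Mathlib's Fourier transform (whose characters are
`exp (2πi⟨x, η⟩)`, so that the angular frequency is `ξ = 2π η`), as a Schwartz function. -/
def schwartzSymbol (j : ℕ) : 𝓢(RSpace d, ℂ) :=
  HasCompactSupport.toSchwartzMap
    (f := fun η : RSpace d => ((φ.symbol j ((2 * Real.pi) • η) : ℝ) : ℂ))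
    (((φ.hasCompactSupport_symbol j).comp_smul (by positivity)).comp_left Complex.ofReal_zero)
    (Complex.ofRealCLM.contDiff.comp ((φ.symbol_smooth j).comp (contDiff_const_smul _)))

/-- The convolution kernel of the `j`-th block: the inverse Fourier transform of `φ_j`, that is
`y ↦ (2π)^{-d} ∫ exp (i⟨ξ, y⟩) φ_j(ξ) dξ`. -/
def kernel (j : ℕ) : 𝓢(RSpace d, ℂ) := 𝓕⁻ (φ.schwartzSymbol j)

/-- The Schwartz function `y ↦ kernel j (x - y)`. -/
def shiftedKernel (j : ℕ) (x : RSpace d) : 𝓢(RSpace d, ℂ) :=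
  SchwartzMap.compSubConstCLM ℂ x
    (SchwartzMap.compCLMOfContinuousLinearEquiv ℂ (ContinuousLinearEquiv.neg ℝ) (φ.kernel j))

theorem shiftedKernel_apply (j : ℕ) (x y : RSpace d) :
    φ.shiftedKernel j x y = φ.kernel j (x - y) := by
  simp [shiftedKernel]

/-- The block operator `R_j F = kernel j * F` on tempered distributions; the convolution of a
Schwartz function with a tempered distribution is a function, and this is its value at `x`. -/
def block (j : ℕ) (F : 𝓢'(RSpace d, ℂ)) (x : RSpace d) : ℂ := F (φ.shiftedKernel j x)

/-- The Besov norm `sup_j 2^{sj} ‖R_j F‖_∞` of a tempered distribution (possibly infinite). -/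
def besovENorm (s : ℝ) (F : 𝓢'(RSpace d, ℂ)) : ℝ≥0∞ :=
  ⨆ j : ℕ, ENNReal.ofReal ((2 : ℝ) ^ (s * j)) * ⨆ x : RSpace d, ‖φ.block j F x‖ₑ

end LPCutoff

/-- The tempered distribution `F` is given by integration against the function `g`. -/
def IsRepresentedBy {d : ℕ} (F : 𝓢'(RSpace d, ℂ)) (g : RSpace d → ℝ) : Prop :=
  ∀ ψ : 𝓢(RSpace d, ℂ),
    Integrable (fun x => ψ x * (g x : ℂ)) ∧ F ψ = ∫ x, ψ x * (g x : ℂ)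

/-- `w ∈ L^∞([0,T]; B^s_∞)`, for `s > 0`: for almost every `t`, the function `w t` is the
(continuous) function representing an element of `B^s_∞`, with norm bounded uniformly in `t`. -/
def MemLinftyBesov {d : ℕ} (φ : LPCutoff d) (T s : ℝ) (w : ℝ → RSpace d → ℝ) : Prop :=
  AEMeasurable (fun p : ℝ × RSpace d => w p.1 p.2) (timeSpaceMeasure d T) ∧
  ∃ M : ℝ≥0, ∀ᵐ t ∂(volume.restrict (Icc 0 T)), Continuous (w t) ∧
    ∃ F : 𝓢'(RSpace d, ℂ), IsRepresentedBy F (w t) ∧ φ.besovENorm s F ≤ M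

/-! ### Hölder-Zygmund norms -/

/-- The Hölder-Zygmund norm of order `s > 0` (possibly infinite):
`‖g‖_∞ + sup_{h ≠ 0} ‖δ_h^m g‖_∞ / |h|^s`, where `δ_h g(x) = g(x+h) - g(x)` and `m - 1` is the
greatest integer less than `s`, that is `m = ⌈s⌉`. -/
def zygmundENorm {d : ℕ} (s : ℝ) (g : RSpace d → ℝ) : ℝ≥0∞ :=
  (⨆ x, ‖g x‖ₑ) +
    ⨆ (h : RSpace d) (_ : h ≠ 0), (⨆ x, ‖(fwdDiff h)^[⌈s⌉₊] g x‖ₑ) / ‖h‖ₑ ^ s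

/-- The norm of `L^∞([0,T]; C^s)`. -/
def LinftyZygmundENorm {d : ℕ} (T s : ℝ) (w : ℝ → RSpace d → ℝ) : ℝ≥0∞ :=
  essSup (fun t => zygmundENorm s (w t)) (volume.restrict (Icc 0 T))

/-- The norm of `L^∞([0,T] × ℝ^d)`. -/
def LinftyENorm {d : ℕ} (T : ℝ) (w : ℝ → RSpace d → ℝ) : ℝ≥0∞ :=
  eLpNorm (fun p : ℝ × RSpace d => w p.1 p.2) ∞ (timeSpaceMeasure d T)

/-! ### The equation -/

/-- The second partial derivative `∂_i ∂_j g`. -/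
def secondPartial {d : ℕ} (i j : Fin d) (g : RSpace d → ℝ) (x : RSpace d) : ℝ :=
  lineDeriv ℝ (fun y => lineDeriv ℝ g y (EuclideanSpace.single j 1)) x
    (EuclideanSpace.single i 1)

/-- `a` is a measurable symmetric matrix-valued function on `ℝ₊ × ℝ^d` which is uniformly elliptic
with constant `c₀` and `β`-Hölder in space (in the Hilbert-Schmidt norm), uniformly in time. -/
structure IsHolderElliptic {d : ℕ} (c₀ β : ℝ) (a : ℝ → RSpace d → Matrix (Fin d) (Fin d) ℝ) :
    Prop where
  measurable : ∀ i j, Measurable fun p : ℝ × RSpace d => a p.1 p.2 i j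
  symm : ∀ t, 0 ≤ t → ∀ x, (a t x).IsSymm
  elliptic : ∀ t, 0 ≤ t → ∀ x ξ : RSpace d,
    c₀⁻¹ * ‖ξ‖ ^ 2 ≤ ∑ i, ∑ j, a t x i j * ξ i * ξ j ∧
      ∑ i, ∑ j, a t x i j * ξ i * ξ j ≤ c₀ * ‖ξ‖ ^ 2
  holder : ∀ t, 0 ≤ t → ∀ x y : RSpace d,
    √(∑ i, ∑ j, (a t x i j - a t y i j) ^ 2) ≤ c₀ * ‖x - y‖ ^ β

/-- `v = ∂_t u` on `[0,T]`, in the integrated sense `u(t,x) = u(0,x) + ∫_0^t v(s,x) ds`. -/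
def IsTimeDerivative {d : ℕ} (T : ℝ) (u v : ℝ → RSpace d → ℝ) : Prop :=
  ∀ x, IntervalIntegrable (fun s => v s x) volume 0 T ∧
    ∀ t ∈ Icc 0 T, u t x = u 0 x + ∫ s in (0 : ℝ)..t, v s x

end

noncomputable section

theorem exists_integrable_bound_translates {d : ℕ} {F : Type} [NormedAddCommGroup F]
    [NormedSpace ℝ F] (K : 𝓢(RSpace d, F)) (x₀ : RSpace d) :
    ∃ bound : RSpace d → ℝ, Integrable bound ∧
      ∀ z, ∀ x ∈ Metric.ball x₀ 1, ‖K (x - z)‖ ≤ bound z := by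
  set k : ℕ := d + 1
  set C : ℝ := 2 ^ k * ((Finset.Iic (k, 0)).sup fun m => SchwartzMap.seminorm ℝ m.1 m.2) K
  have hC : ∀ y, (1 + ‖y‖) ^ k * ‖K y‖ ≤ C := fun y => by
    have := SchwartzMap.one_add_le_sup_seminorm_apply (𝕜 := ℝ) (m := (k, 0)) le_rfl le_rfl K y
    simpa using this
  have hint : Integrable (fun y : RSpace d => (1 + ‖y‖) ^ (-(k : ℝ))) :=
    integrable_one_add_norm (by simp [k])
  refine ⟨fun z => 2 ^ k * C * (1 + ‖x₀ - z‖) ^ (-(k : ℝ)),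
    (hint.comp_sub_left x₀).const_mul _, fun z x hx => ?_⟩
  have h1 : 1 + ‖x₀ - z‖ ≤ 2 * (1 + ‖x - z‖) := by
    have h2 : ‖x₀ - z‖ ≤ ‖x₀ - x‖ + ‖x - z‖ := by
      simpa using norm_add_le (x₀ - x) (x - z)
    have h3 : ‖x₀ - x‖ < 1 := by rw [← dist_eq_norm, dist_comm]; exact hx
    linarith [norm_nonneg (x - z)]
  have hpos : 0 < 1 + ‖x₀ - z‖ := by positivity
  beta_reduce
  rw [Real.rpow_neg hpos.le, Real.rpow_natCast, ← div_eq_mul_inv, le_div_iff₀ (by positivity)]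
  calc ‖K (x - z)‖ * (1 + ‖x₀ - z‖) ^ k ≤ ‖K (x - z)‖ * (2 * (1 + ‖x - z‖)) ^ k := by gcongr
    _ = 2 ^ k * ((1 + ‖x - z‖) ^ k * ‖K (x - z)‖) := by rw [mul_pow]; ring
    _ ≤ 2 ^ k * C := by gcongr; exact hC _

/-- Convolution of a vector-valued Schwartz kernel with a real function. -/
def schwartzConv {d : ℕ} {F : Type} [NormedAddCommGroup F] [NormedSpace ℝ F]
    (K : 𝓢(RSpace d, F)) (b : RSpace d → ℝ) (x : RSpace d) : F :=
  ∫ z, b z • K (x - z)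

section

variable {d : ℕ} {F : Type} [NormedAddCommGroup F] [NormedSpace ℝ F]

theorem integrable_schwartzConv (K : 𝓢(RSpace d, F)) {b : RSpace d → ℝ} {m : ℝ}
    (hb : AEStronglyMeasurable b) (hm : ∀ z, |b z| ≤ m) (x : RSpace d) :
    Integrable fun z => b z • K (x - z) :=
  (K.integrable.comp_sub_left x).bdd_smul m hb (.of_forall hm)

theorem norm_schwartzConv_le (K : 𝓢(RSpace d, F)) {b : RSpace d → ℝ} {m : ℝ}
    (hm : ∀ z, |b z| ≤ m) (x : RSpace d) :
    ‖schwartzConv K b x‖ ≤ (∫ z, ‖K z‖) * m := by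
  have hi : Integrable fun z => ‖K (x - z)‖ := (K.integrable.comp_sub_left x).norm
  calc ‖schwartzConv K b x‖ ≤ ∫ z, ‖K (x - z)‖ * m :=
        norm_integral_le_of_norm_le (hi.mul_const m) (.of_forall fun z => by
          rw [norm_smul, mul_comm]; gcongr; exact hm z)
    _ = (∫ z, ‖K z‖) * m := by
        rw [integral_mul_const, integral_sub_left_eq_self (fun z => ‖K z‖)]

theorem hasFDerivAt_schwartzConv (K : 𝓢(RSpace d, F)) {b : RSpace d → ℝ} {m : ℝ}
    (hb : AEStronglyMeasurable b) (hm : ∀ z, |b z| ≤ m) (x : RSpace d) :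
    HasFDerivAt (schwartzConv K b) (schwartzConv (SchwartzMap.fderivCLM ℝ _ _ K) b x) x := by
  obtain ⟨bd, hbd, hle⟩ := exists_integrable_bound_translates (SchwartzMap.fderivCLM ℝ _ _ K) x
  refine hasFDerivAt_integral_of_dominated_of_fderiv_le (bound := fun z => m * bd z)
    (F' := fun x z => b z • SchwartzMap.fderivCLM ℝ _ _ K (x - z))
    (Metric.ball_mem_nhds x one_pos) ?_ (integrable_schwartzConv K hb hm x)
    (integrable_schwartzConv _ hb hm x).aestronglyMeasurable ?_ (hbd.const_mul m) ?_
  · exact .of_forall fun y => (integrable_schwartzConv K hb hm y).aestronglyMeasurable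
  · refine .of_forall fun z y hy => ?_
    rw [norm_smul]
    exact mul_le_mul (hm z) (hle z y hy) (norm_nonneg _) ((abs_nonneg _).trans (hm z))
  · refine .of_forall fun z y _ => ?_
    have h1 := (K.hasFDerivAt (y - z)).comp y ((hasFDerivAt_id y).sub_const z)
    exact h1.const_smul (b z)

theorem contDiff_schwartzConv (n : ℕ) : ∀ {F : Type} [NormedAddCommGroup F] [NormedSpace ℝ F]
    (K : 𝓢(RSpace d, F)), ∃ C : ℝ, 0 ≤ C ∧ ∀ (b : RSpace d → ℝ) (m : ℝ),
      AEStronglyMeasurable b → (∀ z, |b z| ≤ m) →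
      ContDiff ℝ n (schwartzConv K b) ∧ ∀ x, ‖iteratedFDeriv ℝ n (schwartzConv K b) x‖ ≤ C * m := by
  induction n with
  | zero =>
    intro F _ _ K
    refine ⟨∫ z, ‖K z‖, by positivity, fun b m hb hm => ⟨?_, fun x => ?_⟩⟩
    · exact contDiff_zero.2 (continuous_iff_continuousAt.2 fun x =>
        (hasFDerivAt_schwartzConv K hb hm x).continuousAt)
    · simpa using norm_schwartzConv_le K hm x
  | succ n ih =>
    intro F _ _ K
    obtain ⟨C, hC0, hC⟩ := ih (SchwartzMap.fderivCLM ℝ _ _ K)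
    refine ⟨C, hC0, fun b m hb hm => ?_⟩
    have hd := hasFDerivAt_schwartzConv K hb hm
    have hfd : fderiv ℝ (schwartzConv K b) = schwartzConv (SchwartzMap.fderivCLM ℝ _ _ K) b :=
      funext fun x => (hd x).fderiv
    obtain ⟨h1, h2⟩ := hC b m hb hm
    refine ⟨?_, fun x => ?_⟩
    · have := (contDiff_succ_iff_hasFDerivAt (𝕜 := ℝ) (n := n) (f := schwartzConv K b)).2
        ⟨_, h1, hd⟩
      exact_mod_cast this
    · rw [← norm_iteratedFDeriv_fderiv, hfd]
      exact h2 x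

end

namespace LPCutoff

variable {d : ℕ} (φ : LPCutoff d)

/-- The symbol `φ₀(2^{-J} ξ)` in the normalisation of `schwartzSymbol`. -/
def lowSymbol (J : ℕ) : 𝓢(RSpace d, ℂ) :=
  HasCompactSupport.toSchwartzMap
    (f := fun η : RSpace d => ((φ.toFun ((2 : ℝ)⁻¹ ^ J • (2 * Real.pi) • η) : ℝ) : ℂ))
    (((φ.hasCompactSupport_toFun.comp_smul (c := (2 : ℝ)⁻¹ ^ J) (by positivity)).comp_smul
      (c := 2 * Real.pi) (by positivity)).comp_left Complex.ofReal_zero)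
    (Complex.ofRealCLM.contDiff.comp
      ((φ.smooth.comp (contDiff_const_smul _)).comp (contDiff_const_smul _)))

theorem lowSymbol_apply (J : ℕ) (η : RSpace d) :
    φ.lowSymbol J η = ((φ.toFun ((2 : ℝ)⁻¹ ^ J • (2 * Real.pi) • η) : ℝ) : ℂ) := rfl

theorem schwartzSymbol_apply (j : ℕ) (η : RSpace d) :
    φ.schwartzSymbol j η = ((φ.symbol j ((2 * Real.pi) • η) : ℝ) : ℂ) := rfl

/-- The kernel of the low-frequency projection. -/
def lowKernel (J : ℕ) : 𝓢(RSpace d, ℂ) := 𝓕⁻ (φ.lowSymbol J)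

theorem sum_symbol (J : ℕ) (ξ : RSpace d) :
    ∑ j ∈ Finset.range (J + 1), φ.symbol j ξ = φ.toFun ((2 : ℝ)⁻¹ ^ J • ξ) := by
  induction J with
  | zero => simp [symbol]
  | succ J ih => rw [Finset.sum_range_succ, ih]; simp [symbol]

theorem sum_kernel (J : ℕ) : ∑ j ∈ Finset.range (J + 1), φ.kernel j = φ.lowKernel J := by
  have h : φ.lowSymbol J = ∑ j ∈ Finset.range (J + 1), φ.schwartzSymbol j := by
    ext η
    rw [lowSymbol_apply, sum_apply]
    simp_rw [schwartzSymbol_apply, ← sum_symbol, Complex.ofReal_sum]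
  rw [lowKernel, h, FourierTransform.fourierInv_sum]
  rfl

theorem toFun_mul_symbol (j : ℕ) (ξ : RSpace d) :
    φ.toFun ((2 : ℝ)⁻¹ ^ (j + 1) • ξ) * φ.symbol j ξ = φ.symbol j ξ := by
  by_cases h : ‖ξ‖ ≤ 2 ^ (j + 1)
  · rw [φ.eq_one, one_mul]
    rw [norm_smul, norm_pow, norm_inv, Real.norm_ofNat, inv_pow]
    exact inv_mul_le_one_of_le₀ h (by positivity)
  · push Not at h
    have hj (k : ℕ) (hk : k ≤ j) : φ.toFun ((2 : ℝ)⁻¹ ^ k • ξ) = 0 := by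
      refine φ.eq_zero _ ?_
      rw [norm_smul, norm_pow, norm_inv, Real.norm_ofNat, inv_pow, inv_mul_eq_div,
        lt_div_iff₀ (by positivity), ← pow_succ']
      exact (pow_le_pow_right₀ one_le_two (by omega)).trans_lt h
    have : φ.symbol j ξ = 0 := by
      cases j with
      | zero => simpa [symbol] using hj 0 le_rfl
      | succ j =>
        have h1 := hj (j + 1) le_rfl
        have h2 := hj j (by omega)
        simp only [symbol, h1, h2, sub_self]
    rw [this, mul_zero]

theorem kernel_eq_convolution (j : ℕ) (x : RSpace d) :
    φ.kernel j x = convolution (φ.lowKernel (j + 1)) (φ.kernel j) (ContinuousLinearMap.mul ℂ ℂ)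
      volume x := by
  rw [← SchwartzMap.convolution_apply]
  congr 1
  have h := SchwartzMap.fourier_convolution (ContinuousLinearMap.mul ℂ ℂ) (φ.lowKernel (j + 1))
    (φ.kernel j)
  have h2 : SchwartzMap.pairing (ContinuousLinearMap.mul ℂ ℂ) (φ.lowSymbol (j + 1))
      (φ.schwartzSymbol j) = φ.schwartzSymbol j := by
    ext η
    rw [SchwartzMap.pairing_apply_apply, ContinuousLinearMap.mul_apply', lowSymbol_apply,
      schwartzSymbol_apply, ← Complex.ofReal_mul, toFun_mul_symbol]
  rw [lowKernel, kernel, FourierTransform.fourier_fourierInv_eq,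
    FourierTransform.fourier_fourierInv_eq, h2] at h
  calc φ.kernel j = 𝓕⁻ (φ.schwartzSymbol j) := rfl
    _ = _ := by
      rw [← h, FourierTransform.fourierInv_fourier_eq]
      rfl

theorem lowKernel_apply (J : ℕ) (x : RSpace d) :
    φ.lowKernel J x = ((2 : ℝ) ^ J) ^ d • φ.lowKernel 0 ((2 : ℝ) ^ J • x) := by
  rw [lowKernel, lowKernel, SchwartzMap.fourierInv_coe, SchwartzMap.fourierInv_coe,
    Real.fourierInv_eq', Real.fourierInv_eq']
  have h := Measure.integral_comp_smul volume (fun v : RSpace d =>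
    Complex.exp (↑(2 * Real.pi * inner ℝ v ((2 : ℝ) ^ J • x)) * Complex.I) • φ.lowSymbol 0 v)
    ((2 : ℝ)⁻¹ ^ J)
  have hc : |(((2 : ℝ)⁻¹ ^ J) ^ Module.finrank ℝ (RSpace d))⁻¹| = ((2 : ℝ) ^ J) ^ d := by
    rw [abs_of_nonneg (by positivity), finrank_euclideanSpace_fin, inv_pow, inv_pow, inv_inv]
  rw [hc] at h
  rw [← h]
  refine integral_congr_ae (.of_forall fun v => ?_)
  simp only [lowSymbol_apply, inner_smul_left, inner_smul_right, pow_zero, one_smul]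
  congr 3
  · norm_cast
    simp only [inv_pow, conj_trivial]
    push_cast
    rw [mul_inv_cancel_left₀ (by positivity)]
  · rw [smul_comm]

theorem integral_lowKernel_zero : ∫ y, φ.lowKernel 0 y = 1 := by
  have h : 𝓕 (φ.lowKernel 0) 0 = φ.lowSymbol 0 0 := by
    rw [lowKernel, FourierTransform.fourier_fourierInv_eq]
  rw [SchwartzMap.fourier_coe, Real.fourier_eq'] at h
  simpa [lowSymbol_apply, φ.eq_one 0 (by simp)] using h

theorem schwartzConv_lowKernel (J : ℕ) (b : RSpace d → ℝ) (x : RSpace d) :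
    schwartzConv (φ.lowKernel J) b x =
      schwartzConv (φ.lowKernel 0) (fun z => b ((2 : ℝ)⁻¹ ^ J • z)) ((2 : ℝ) ^ J • x) := by
  have h := Measure.integral_comp_smul volume (fun z : RSpace d =>
    b ((2 : ℝ)⁻¹ ^ J • z) • φ.lowKernel 0 ((2 : ℝ) ^ J • x - z)) ((2 : ℝ) ^ J)
  have hc : |(((2 : ℝ) ^ J) ^ Module.finrank ℝ (RSpace d))⁻¹| = (((2 : ℝ) ^ J) ^ d)⁻¹ := by
    rw [abs_of_nonneg (by positivity), finrank_euclideanSpace_fin]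
  rw [hc, eq_inv_smul_iff₀ (by positivity), ← integral_smul] at h
  rw [schwartzConv, schwartzConv, ← h]
  refine integral_congr_ae (.of_forall fun z => ?_)
  simp only
  rw [lowKernel_apply, smul_smul, smul_smul, ← smul_sub, smul_smul, ← mul_pow,
    inv_mul_cancel₀ two_ne_zero, one_pow, one_smul, mul_comm]

theorem bernstein_lowKernel (n : ℕ) : ∃ C : ℝ, 0 ≤ C ∧
    ∀ (J : ℕ) (b : RSpace d → ℝ) (m : ℝ), Continuous b → (∀ z, |b z| ≤ m) →
      ContDiff ℝ n (schwartzConv (φ.lowKernel J) b) ∧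
      ∀ x, ‖iteratedFDeriv ℝ n (schwartzConv (φ.lowKernel J) b) x‖ ≤ C * (2 ^ J) ^ n * m := by
  obtain ⟨C, hC0, hC⟩ := contDiff_schwartzConv n (φ.lowKernel 0)
  refine ⟨C, hC0, fun J b m hb hm => ?_⟩
  obtain ⟨h1, h2⟩ := hC (fun z => b ((2 : ℝ)⁻¹ ^ J • z)) m
    (hb.comp (continuous_const_smul _)).aestronglyMeasurable (fun z => hm _)
  have he : schwartzConv (φ.lowKernel J) b = fun x =>
      schwartzConv (φ.lowKernel 0) (fun z => b ((2 : ℝ)⁻¹ ^ J • z)) ((2 : ℝ) ^ J • x) :=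
    funext (φ.schwartzConv_lowKernel J b)
  rw [he]
  refine ⟨h1.comp (contDiff_const_smul _), fun x => ?_⟩
  rw [iteratedFDeriv_comp_const_smul _ h1, norm_smul, norm_pow, norm_pow, Real.norm_ofNat]
  calc _ ≤ ((2 : ℝ) ^ J) ^ n * (C * m) := by gcongr; exact h2 _
    _ = _ := by ring

theorem tendsto_schwartzConv_lowKernel {g : RSpace d → ℝ} {U : ℝ} (hg : Continuous g)
    (hU : ∀ x, |g x| ≤ U) (x : RSpace d) :
    Filter.Tendsto (fun J => schwartzConv (φ.lowKernel J) g x) Filter.atTop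
      (nhds (g x : ℂ)) := by
  have he (J : ℕ) : schwartzConv (φ.lowKernel J) g x =
      ∫ y, g (x - (2 : ℝ)⁻¹ ^ J • y) • φ.lowKernel 0 y := by
    rw [schwartzConv_lowKernel, schwartzConv, ← integral_sub_left_eq_self _ _ ((2 : ℝ) ^ J • x)]
    simp only [smul_sub, sub_sub_cancel, smul_smul, ← mul_pow]
    simp
  simp_rw [he]
  have hlim : (g x : ℂ) = ∫ y, g x • φ.lowKernel 0 y := by
    rw [integral_smul, integral_lowKernel_zero]; simp
  rw [hlim]
  refine tendsto_integral_of_dominated_convergence (fun y => U * ‖φ.lowKernel 0 y‖) (fun J => ?_)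
    ((φ.lowKernel 0).integrable.norm.const_mul U) (fun J => .of_forall fun y => ?_)
    (.of_forall fun y => ?_)
  · exact ((hg.comp (by fun_prop : Continuous fun y : RSpace d => x - (2 : ℝ)⁻¹ ^ J • y)).smul
      (φ.lowKernel 0).continuous).aestronglyMeasurable
  · rw [norm_smul]; gcongr; exact hU _
  · refine Filter.Tendsto.smul ?_ tendsto_const_nhds
    refine (hg.tendsto x).comp ?_
    have : Filter.Tendsto (fun J : ℕ => x - (2 : ℝ)⁻¹ ^ J • y) Filter.atTop
        (nhds (x - (0 : ℝ) • y)) :=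
      tendsto_const_nhds.sub ((tendsto_pow_atTop_nhds_zero_of_lt_one (by norm_num)
        (by norm_num)).smul_const y)
    simpa using this

/-- Littlewood-Paley blocks of a bounded function reproduce under a low-frequency projection. -/
theorem schwartzConv_kernel_reproducing {g : RSpace d → ℝ} {U : ℝ} (hg : Continuous g)
    (hU : ∀ x, |g x| ≤ U) (j : ℕ) (x : RSpace d) :
    schwartzConv (φ.kernel j) g x =
      schwartzConv (φ.lowKernel (j + 1)) (fun z => (schwartzConv (φ.kernel j) g z).re) x +
      schwartzConv (φ.lowKernel (j + 1)) (fun z => (schwartzConv (φ.kernel j) g z).im) x *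
        Complex.I := by
  set Q := φ.lowKernel (j + 1)
  set K := φ.kernel j
  set G : RSpace d → ℂ := fun y => (g y : ℂ)
  have hGc : Continuous G := by fun_prop
  have hGb : ∀ y, ‖G y‖ ≤ U := fun y => by simpa [G] using hU y
  let L := ContinuousLinearMap.mul ℂ ℂ
  have hconv (P : 𝓢(RSpace d, ℂ)) (x : RSpace d) :
      schwartzConv P g x = convolution P G L volume x := by
    rw [schwartzConv, convolution, ← integral_sub_left_eq_self _ _ x]
    refine integral_congr_ae (.of_forall fun z => ?_)
    simp [L, G, mul_comm]
  have hB : convolution K G L volume = schwartzConv K g := funext fun y => (hconv K y).symm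
  have hBc : Continuous (schwartzConv K g) := continuous_iff_continuousAt.2 fun y =>
    (hasFDerivAt_schwartzConv K hg.aestronglyMeasurable hU y).continuousAt
  have hBb : ∀ y, ‖schwartzConv K g y‖ ≤ (∫ z, ‖K z‖) * U := norm_schwartzConv_le K hU
  have hassoc : convolution (convolution Q K L volume) G L volume x =
      convolution Q (convolution K G L volume) L volume x := by
    refine convolution_assoc' L L L L (fun a b c => by simp [L, mul_assoc]) ?_ ?_ ?_
    · exact .of_forall fun y => (K.integrable.comp_sub_left y).bdd_mul
        Q.continuous.aestronglyMeasurable (c := SchwartzMap.seminorm ℝ 0 0 Q)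
        (.of_forall fun z => SchwartzMap.norm_le_seminorm ℝ Q z)
    · exact .of_forall fun y => K.integrable.mul_bdd (c := U)
        (hGc.comp (by fun_prop)).aestronglyMeasurable (.of_forall fun z => hGb _)
    · have h1 := (Q.integrable (μ := volume)).convolution_integrand L (K.integrable (μ := volume))
      refine (h1.mul_bdd (c := U) (g := fun p => G (x - p.1)) (by fun_prop)
        (.of_forall fun p => hGb _)).congr (.of_forall fun p => ?_)
      simp [L, mul_assoc, Function.uncurry]
  have hK : convolution Q K L volume = K := funext fun y => (φ.kernel_eq_convolution j y).symm
  rw [hK, hB] at hassoc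
  rw [hassoc, convolution, ← integral_sub_left_eq_self _ _ x]
  simp only [sub_sub_cancel, L, ContinuousLinearMap.mul_apply']
  have hre := integrable_schwartzConv Q (b := fun z => (schwartzConv K g z).re)
    (by fun_prop) (fun z => (Complex.abs_re_le_norm _).trans (hBb z)) x
  have him := integrable_schwartzConv Q (b := fun z => (schwartzConv K g z).im)
    (by fun_prop) (fun z => (Complex.abs_im_le_norm _).trans (hBb z)) x
  rw [schwartzConv, schwartzConv, ← integral_mul_const, ← integral_add hre (him.mul_const _)]
  refine integral_congr_ae (.of_forall fun z => ?_)
  simp only [Complex.real_smul]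
  nth_rewrite 1 [← Complex.re_add_im (schwartzConv K g z)]
  ring

end LPCutoff

theorem fwdDiff_iter_three {E F : Type*} [AddCommGroup E] [AddCommGroup F] [Module ℝ F]
    (h : E) (f : E → F) (x : E) :
    (fwdDiff h)^[3] f x =
      f (x + h + h + h) - (3 : ℝ) • f (x + h + h) + (3 : ℝ) • f (x + h) - f x := by
  simp only [Function.iterate_succ, Function.iterate_zero, Function.comp_apply, id_eq, fwdDiff]
  module

theorem norm_fwdDiff_iter_le {E F : Type*} [NormedAddCommGroup E] [NormedSpace ℝ E]
    [NormedAddCommGroup F] [NormedSpace ℝ F] (h : E) {C : ℝ} (n : ℕ) :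
    ∀ {f : E → F}, ContDiff ℝ n f → (∀ x, ‖iteratedFDeriv ℝ n f x‖ ≤ C) →
      ∀ x, ‖(fwdDiff h)^[n] f x‖ ≤ C * ‖h‖ ^ n := by
  induction n generalizing C with
  | zero => intro f _ hf x; simpa using hf x
  | succ n ih =>
    intro f hc hf x
    rw [Function.iterate_succ_apply, pow_succ', ← mul_assoc]
    have hc' : ContDiff ℝ n f := hc.of_le (by exact_mod_cast n.le_succ)
    have hcs : ContDiff ℝ n fun y => f (y + h) := hc'.comp (contDiff_id.add contDiff_const)
    refine ih (f := fwdDiff h f) (hcs.sub hc') (fun y => ?_) x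
    have h1 : iteratedFDeriv ℝ n (fwdDiff h f) y =
        iteratedFDeriv ℝ n f (y + h) - iteratedFDeriv ℝ n f y := by
      rw [← iteratedFDeriv_comp_add_right]
      exact iteratedFDeriv_sub_apply hcs.contDiffAt hc'.contDiffAt
    rw [h1]
    have := Convex.norm_image_sub_le_of_norm_fderiv_le (𝕜 := ℝ) (f := iteratedFDeriv ℝ n f)
      (s := univ) (x := y) (y := y + h) (C := C)
      (fun z _ => (hc.differentiable_iteratedFDeriv (by exact_mod_cast n.lt_succ_self)) z)
      (fun z _ => by rw [norm_fderiv_iteratedFDeriv]; exact hf z) convex_univ trivial trivial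
    simpa using this

namespace LPCutoff

variable {d : ℕ} (φ : LPCutoff d)

theorem block_eq_schwartzConv {F : 𝓢'(RSpace d, ℂ)} {g : RSpace d → ℝ}
    (hF : IsRepresentedBy F g) (j : ℕ) (x : RSpace d) :
    φ.block j F x = schwartzConv (φ.kernel j) g x := by
  rw [block, (hF _).2, schwartzConv]
  simp only [shiftedKernel_apply, Complex.real_smul, mul_comm]

theorem norm_block_le {s : ℝ} {F : 𝓢'(RSpace d, ℂ)} {M : ℝ≥0} (hM : φ.besovENorm s F ≤ M)
    (j : ℕ) (x : RSpace d) : (2 : ℝ) ^ (s * j) * ‖φ.block j F x‖ ≤ M := by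
  have h1 : ENNReal.ofReal ((2 : ℝ) ^ (s * j)) * ‖φ.block j F x‖ₑ ≤ M :=
    le_trans (by gcongr; exact le_iSup (fun x => ‖φ.block j F x‖ₑ) x)
      ((le_iSup (fun j : ℕ => ENNReal.ofReal ((2 : ℝ) ^ (s * j)) *
        ⨆ x : RSpace d, ‖φ.block j F x‖ₑ) j).trans hM)
  rw [← ofReal_norm, ← ENNReal.ofReal_mul (by positivity),
    ENNReal.ofReal_le_iff_le_toReal ENNReal.coe_ne_top] at h1
  simpa using h1

theorem bernstein_block (n : ℕ) : ∃ C : ℝ, 0 ≤ C ∧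
    ∀ (j : ℕ) (g : RSpace d → ℝ) (U m : ℝ), Continuous g → (∀ z, |g z| ≤ U) →
      (∀ z, ‖schwartzConv (φ.kernel j) g z‖ ≤ m) →
      ContDiff ℝ n (schwartzConv (φ.kernel j) g) ∧
      ∀ x, ‖iteratedFDeriv ℝ n (schwartzConv (φ.kernel j) g) x‖ ≤ C * (2 ^ j) ^ n * m := by
  obtain ⟨C, hC0, hC⟩ := φ.bernstein_lowKernel n
  refine ⟨2 * 2 ^ n * C, by positivity, fun j g U m hg hU hm => ?_⟩
  set B := schwartzConv (φ.kernel j) g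
  have hBc : Continuous B := continuous_iff_continuousAt.2 fun y =>
    (hasFDerivAt_schwartzConv _ hg.aestronglyMeasurable hU y).continuousAt
  obtain ⟨r1, r2⟩ := hC (j + 1) (fun z => (B z).re) m (by fun_prop)
    (fun z => (Complex.abs_re_le_norm _).trans (hm z))
  obtain ⟨i1, i2⟩ := hC (j + 1) (fun z => (B z).im) m (by fun_prop)
    (fun z => (Complex.abs_im_le_norm _).trans (hm z))
  set R := schwartzConv (φ.lowKernel (j + 1)) (fun z => (B z).re)
  set S := schwartzConv (φ.lowKernel (j + 1)) (fun z => (B z).im)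
  have hB : B = R + fun x => Complex.I • S x := funext fun x => by
    rw [Pi.add_apply, smul_eq_mul, mul_comm]
    exact φ.schwartzConv_kernel_reproducing hg hU j x
  have i1' : ContDiff ℝ n fun x => Complex.I • S x :=
    i1.const_smul Complex.I
  rw [hB]
  refine ⟨r1.add i1', fun x => ?_⟩
  have i3 : ‖iteratedFDeriv ℝ n (fun x => Complex.I • S x) x‖ ≤ C * (2 ^ (j + 1)) ^ n * m := by
    refine le_trans (le_of_eq ?_) (i2 x)
    have : iteratedFDeriv ℝ n (fun x => Complex.I • S x) x = Complex.I • iteratedFDeriv ℝ n S x :=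
      iteratedFDeriv_const_smul_apply' i1.contDiffAt
    rw [this, norm_smul, Complex.norm_I, one_mul]
  rw [iteratedFDeriv_add_apply r1.contDiffAt i1'.contDiffAt]
  calc _ ≤ C * (2 ^ (j + 1)) ^ n * m + C * (2 ^ (j + 1)) ^ n * m :=
        norm_add_le_of_le (r2 x) i3
    _ = _ := by rw [pow_succ (2 : ℝ) j, mul_pow]; ring

theorem hasSum_block {g : RSpace d → ℝ} {U : ℝ} (hg : Continuous g)
    (hU : ∀ x, |g x| ≤ U) (x : RSpace d)
    (hs : Summable fun j => schwartzConv (φ.kernel j) g x) :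
    HasSum (fun j => schwartzConv (φ.kernel j) g x) (g x : ℂ) := by
  refine (hs.hasSum_iff_tendsto_nat).2 ?_
  refine (Filter.tendsto_add_atTop_iff_nat 1).1 ?_
  refine (φ.tendsto_schwartzConv_lowKernel hg hU x).congr fun J => ?_
  rw [← sum_kernel, schwartzConv]
  simp only [sum_apply, Finset.smul_sum]
  rw [integral_finsetSum _ fun j _ => integrable_schwartzConv _ hg.aestronglyMeasurable hU x]
  rfl

/-- Functions with bounded `B^{2+β}` norm are `C^2` with quantitative bounds. -/
theorem besov_regularity {β : ℝ} (hβ : β ∈ Ioo (0 : ℝ) 1) (M : ℝ≥0) :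
    ∃ D N : ℝ, ∀ (g : RSpace d → ℝ) (U : ℝ) (F : 𝓢'(RSpace d, ℂ)), Continuous g →
      (∀ x, |g x| ≤ U) → IsRepresentedBy F g → φ.besovENorm (2 + β) F ≤ M →
      ContDiff ℝ 2 g ∧ (∀ x, ‖iteratedFDeriv ℝ 2 g x‖ ≤ D) ∧
      ∀ x h, |(fwdDiff h)^[3] g x| ≤ N * ‖h‖ ^ (2 + β / 2) := by
  choose C hC0 hC using φ.bernstein_block
  obtain ⟨hβ0, hβ1⟩ := hβ
  set q : ℝ := (2 : ℝ) ^ (-β)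
  have hq0 : 0 < q := by positivity
  have hq1 : q < 1 := Real.rpow_lt_one_of_one_lt_of_neg one_lt_two (by linarith)
  set p : ℝ := (2 : ℝ) ^ (-(β / 2))
  have hp0 : 0 < p := by positivity
  have hp1 : p < 1 := Real.rpow_lt_one_of_one_lt_of_neg one_lt_two (by linarith)
  have hsq := summable_geometric_of_lt_one hq0.le hq1
  have hsp := summable_geometric_of_lt_one hp0.le hp1
  set N : ℝ := ∑' j : ℕ, (8 + C 3) * M * p ^ j
  refine ⟨∑' j : ℕ, C 2 * M * q ^ j, N, fun g U F hg hU hF hM => ?_⟩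
  set B : ℕ → RSpace d → ℂ := fun j => schwartzConv (φ.kernel j) g
  have hB (j : ℕ) (x : RSpace d) : ‖B j x‖ ≤ M * ((4 : ℝ) ^ j)⁻¹ * q ^ j := by
    have h1 := φ.norm_block_le hM j x
    rw [φ.block_eq_schwartzConv hF] at h1
    have h2 : M * ((4 : ℝ) ^ j)⁻¹ * q ^ j = M / (2 : ℝ) ^ ((2 + β) * j) := by
      have h4 : (2 : ℝ) ^ ((2 + β) * j) = 4 ^ j * (q ^ j)⁻¹ := by
        rw [← Real.rpow_natCast q, ← Real.rpow_mul two_pos.le, ← Real.rpow_neg two_pos.le,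
          add_mul, Real.rpow_add two_pos]
        congr 1
        · rw [Real.rpow_mul two_pos.le, Real.rpow_natCast]; norm_num
        · congr 1; ring
      rw [h4]; field_simp
    rw [h2, le_div_iff₀ (by positivity), mul_comm]
    exact h1
  have hBn (n j : ℕ) := hC n j g U _ hg hU (hB j)
  have h4 (j : ℕ) : (4 : ℝ) ^ j = (2 ^ j) ^ 2 := by rw [← pow_mul, mul_comm, pow_mul]; norm_num
  have hbound (n : ℕ) (hn : n ≤ 2) (j : ℕ) (x : RSpace d) :
      ‖iteratedFDeriv ℝ n (B j) x‖ ≤ C n * M * q ^ j := by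
    refine ((hBn n j).2 x).trans ?_
    have h1 : ((2 : ℝ) ^ j) ^ n ≤ (2 ^ j) ^ 2 :=
      pow_le_pow_right₀ (one_le_pow₀ one_le_two) hn
    calc C n * (2 ^ j) ^ n * (M * (4 ^ j)⁻¹ * q ^ j)
        ≤ C n * (2 ^ j) ^ 2 * (M * (4 ^ j)⁻¹ * q ^ j) := by gcongr; exact hC0 n
      _ = C n * M * q ^ j := by rw [h4]; field_simp
  have hsumn (n : ℕ) : Summable fun j => C n * M * q ^ j := hsq.mul_left _
  have hBs (x : RSpace d) : Summable fun j => B j x :=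
    .of_norm_bounded (hsumn 0) fun j => by simpa using hbound 0 (by norm_num) j x
  have hsum (x : RSpace d) : HasSum (fun j => B j x) (g x : ℂ) := φ.hasSum_block hg hU x (hBs x)
  have hG : (fun x => ∑' j, B j x) = fun x => (g x : ℂ) := funext fun x => (hsum x).tsum_eq
  have hBc : ∀ j, ContDiff ℝ ((2 : ℕ) : ℕ∞) (B j) := fun j => (hBn 2 j).1
  have hcd : ContDiff ℝ ((2 : ℕ) : ℕ∞) fun x => (g x : ℂ) := by
    rw [← hG]
    exact contDiff_tsum (v := fun n j => C n * M * q ^ j) hBc (fun n _ => hsumn n)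
      fun n j x hn => hbound n (by exact_mod_cast hn) j x
  have hre : g = fun x => Complex.reCLM (g x : ℂ) := by ext; simp
  refine ⟨?_, fun x => ?_, fun x h => ?_⟩
  · rw [hre]; exact Complex.reCLM.contDiff.comp hcd
  · have h1 : ‖iteratedFDeriv ℝ 2 (fun x => (g x : ℂ)) x‖ ≤ ∑' j : ℕ, C 2 * M * q ^ j := by
      rw [← hG, iteratedFDeriv_tsum_apply (v := fun n j => C n * M * q ^ j) (N := (2 : ℕ)) hBc
        (fun n _ => hsumn n) (fun n j x hn => hbound n (by exact_mod_cast hn) j x) le_rfl]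
      exact tsum_of_norm_bounded (hsumn 2).hasSum fun j => hbound 2 le_rfl j x
    refine le_trans ?_ h1
    have h2 : iteratedFDeriv ℝ 2 g x = Complex.reCLM.compContinuousMultilinearMap
        (iteratedFDeriv ℝ 2 (fun x => (g x : ℂ)) x) := by
      nth_rewrite 1 [hre]
      exact Complex.reCLM.iteratedFDeriv_comp_left hcd.contDiffAt (i := 2) (by norm_cast)
    rw [h2]
    refine (Complex.reCLM.norm_compContinuousMultilinearMap_le _).trans ?_
    simp
  · have h3 : HasSum (fun j => (fwdDiff h)^[3] (B j) x) (((fwdDiff h)^[3] g x : ℝ) : ℂ) := by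
      have e1 : (fun j => (fwdDiff h)^[3] (B j) x) = fun j => B j (x + h + h + h) -
          (3 : ℝ) • B j (x + h + h) + (3 : ℝ) • B j (x + h) - B j x :=
        funext fun j => fwdDiff_iter_three h (B j) x
      have e2 : (((fwdDiff h)^[3] g x : ℝ) : ℂ) = (g (x + h + h + h) : ℂ) -
          (3 : ℝ) • (g (x + h + h) : ℂ) + (3 : ℝ) • (g (x + h) : ℂ) - (g x : ℂ) := by
        rw [fwdDiff_iter_three (F := ℝ)]; simp
      rw [e1, e2]
      exact (((hsum (x + h + h + h)).sub ((hsum (x + h + h)).const_smul (3 : ℝ))).add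
        ((hsum (x + h)).const_smul (3 : ℝ))).sub (hsum x)
    have h5 (j : ℕ) : ‖(fwdDiff h)^[3] (B j) x‖ ≤
        (8 + C 3) * M * p ^ j * ‖h‖ ^ (2 + β / 2) := by
      set mj := M * ((4 : ℝ) ^ j)⁻¹ * q ^ j
      have hmj : 0 ≤ mj := by positivity
      have hC3 := hC0 3
      set y : ℝ := 2 ^ j * ‖h‖
      have hy : 0 ≤ y := by positivity
      have b1 : ‖(fwdDiff h)^[3] (B j) x‖ ≤ 8 * mj := by
        have h9 (z : RSpace d) : ‖(3 : ℝ) • B j z‖ ≤ 3 * mj := by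
          rw [norm_smul, Real.norm_ofNat]; gcongr; exact hB j z
        rw [fwdDiff_iter_three]
        refine (norm_sub_le_of_le (norm_add_le_of_le (norm_sub_le_of_le (hB j _)
          (h9 _))
          (h9 _)) (hB j _)).trans ?_
        linarith
      have b2 : ‖(fwdDiff h)^[3] (B j) x‖ ≤ C 3 * mj * y ^ 3 := by
        refine (norm_fwdDiff_iter_le h 3 (hBn 3 j).1 (hBn 3 j).2 x).trans (le_of_eq ?_)
        simp only [y, mj]; ring
      have b3 : ‖(fwdDiff h)^[3] (B j) x‖ ≤ (8 + C 3) * mj * y ^ (2 + β / 2) := by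
        rcases le_total y 1 with h1 | h1
        · rcases hy.eq_or_lt with h0 | h0
          · rw [← h0] at b2 ⊢
            rw [Real.zero_rpow (by positivity)]
            simpa using b2
          · have : y ^ 3 ≤ y ^ (2 + β / 2) := by
              rw [← Real.rpow_natCast]
              exact Real.rpow_le_rpow_of_exponent_ge h0 h1 (by push_cast; linarith)
            calc _ ≤ C 3 * mj * y ^ 3 := b2
              _ ≤ (8 + C 3) * mj * y ^ (2 + β / 2) := by gcongr; linarith
        · have : 1 ≤ y ^ (2 + β / 2) := Real.one_le_rpow h1 (by positivity)
          calc _ ≤ 8 * mj * 1 := by simpa using b1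
            _ ≤ (8 + C 3) * mj * y ^ (2 + β / 2) := by gcongr; linarith
      refine b3.trans (le_of_eq ?_)
      have h6 : y ^ (2 + β / 2) = 4 ^ j * (p ^ j)⁻¹ * ‖h‖ ^ (2 + β / 2) := by
        rw [Real.mul_rpow (by positivity) (norm_nonneg h)]
        congr 1
        have h9 : ((2 : ℝ) ^ j) ^ (β / 2) = (p ^ j)⁻¹ := by
          rw [← inv_pow, ← Real.rpow_neg two_pos.le, neg_neg, ← Real.rpow_natCast,
            ← Real.rpow_natCast, ← Real.rpow_mul two_pos.le, ← Real.rpow_mul two_pos.le, mul_comm]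
        rw [Real.rpow_add (by positivity), h4, Real.rpow_two, h9]
      have h7 : q ^ j = p ^ j * p ^ j := by
        rw [← mul_pow, ← Real.rpow_add two_pos, ← neg_add, add_halves]
      rw [h6]
      simp only [mj, h7]
      field_simp
    have h8 := tsum_of_norm_bounded ((hsp.mul_left ((8 + C 3) * M)).hasSum.mul_right
      (‖h‖ ^ (2 + β / 2))) h5
    rw [h3.tsum_eq] at h8
    simpa using h8

end LPCutoff

/-- The symmetric second difference `g(x+h) + g(x-h) - 2 g(x)`. -/
def symmDiff2 {E : Type*} [AddCommGroup E] (h : E) (g : E → ℝ) (x : E) : ℝ :=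
  g (x + h) + g (x - h) - 2 * g x

/-- The Hessian of `g` at `x`, as a bilinear form. -/
abbrev hess {E : Type*} [NormedAddCommGroup E] [NormedSpace ℝ E] (g : E → ℝ) (x : E) :
    E →L[ℝ] E →L[ℝ] ℝ := fderiv ℝ (fderiv ℝ g) x

section

variable {E : Type*} [NormedAddCommGroup E] [NormedSpace ℝ E]

theorem hasFDerivAt_fderiv_apply {g : E → ℝ} (hg : ContDiff ℝ 2 g) (x b : E) :
    HasFDerivAt (fun y => fderiv ℝ g y b) ((ContinuousLinearMap.apply ℝ ℝ b).comp (hess g x)) x :=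
  (ContinuousLinearMap.apply ℝ ℝ b).hasFDerivAt.comp x
    ((hg.fderiv_right (m := 1) (by norm_num)).differentiable (by norm_num) x).hasFDerivAt

theorem tendsto_symmDiff2_div {g : E → ℝ} (hg : ContDiff ℝ 2 g) (x b : E) :
    Filter.Tendsto (fun s : ℝ => symmDiff2 (s • b) g x / s ^ 2) (nhdsWithin 0 {0}ᶜ)
      (nhds (hess g x b b)) := by
  have hd1 : Differentiable ℝ g := hg.differentiable (by norm_num)
  have hp (s : ℝ) : HasDerivAt (fun s : ℝ => x + s • b) b s := by
    simpa using ((hasDerivAt_id s).smul_const b).const_add x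
  have hm (s : ℝ) : HasDerivAt (fun s : ℝ => x - s • b) (-b) s := by
    simpa using ((hasDerivAt_id s).smul_const b).const_sub x
  have hf (s : ℝ) : HasDerivAt (fun s : ℝ => symmDiff2 (s • b) g x)
      (fderiv ℝ g (x + s • b) b - fderiv ℝ g (x - s • b) b) s := by
    have h1 := (hd1 (x + s • b)).hasFDerivAt.comp_hasDerivAt s (hp s)
    have h2 := (hd1 (x - s • b)).hasFDerivAt.comp_hasDerivAt s (hm s)
    have := (h1.add h2).sub_const (2 * g x)
    rw [map_neg, ← sub_eq_add_neg] at this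
    exact this
  have hf' : HasDerivAt (fun s : ℝ => fderiv ℝ g (x + s • b) b - fderiv ℝ g (x - s • b) b)
      (2 * hess g x b b) 0 := by
    have h0 := hasFDerivAt_fderiv_apply hg x b
    have h1 := h0.comp_hasDerivAt_of_eq 0 (hp 0) (by simp)
    have h2 := h0.comp_hasDerivAt_of_eq 0 (hm 0) (by simp)
    have := h1.sub h2
    rw [map_neg, sub_neg_eq_add, ← two_mul] at this
    exact this
  refine HasDerivAt.lhopital_zero_nhdsNE
    (f' := fun s => fderiv ℝ g (x + s • b) b - fderiv ℝ g (x - s • b) b)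
    (g' := fun s : ℝ => 2 * s) (.of_forall hf) (.of_forall fun s => ?_) ?_ ?_ ?_ ?_
  · simpa using hasDerivAt_pow 2 s
  · filter_upwards [self_mem_nhdsWithin] with s hs
    exact mul_ne_zero two_ne_zero hs
  · refine tendsto_nhdsWithin_of_tendsto_nhds ?_
    simpa [symmDiff2, two_mul] using (hf 0).continuousAt.tendsto
  · refine tendsto_nhdsWithin_of_tendsto_nhds ?_
    simpa using (continuous_pow (M := ℝ) 2).tendsto 0
  · have h1 := hf'.tendsto_slope.const_mul (2⁻¹ : ℝ)
    rw [inv_mul_cancel_left₀ two_ne_zero] at h1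
    refine h1.congr' ?_
    filter_upwards [self_mem_nhdsWithin] with s hs
    have : s ≠ 0 := hs
    simp only [slope_def_field, zero_smul, add_zero, sub_zero, sub_self]
    field_simp

theorem symmDiff2_double {E : Type*} [AddCommGroup E] (h : E) (g : E → ℝ) (x : E) :
    symmDiff2 (h + h) g x - 4 * symmDiff2 h g x =
      (fwdDiff h)^[3] g (x - h) - (fwdDiff h)^[3] g (x - (h + h)) := by
  rw [fwdDiff_iter_three (F := ℝ), fwdDiff_iter_three (F := ℝ), symmDiff2, symmDiff2]
  have e1 : x - h + h + h + h = x + (h + h) := by abel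
  have e2 : x - h + h + h = x + h := by abel
  have e3 : x - h + h = x := by abel
  have e4 : x - (h + h) + h + h + h = x + h := by abel
  have e5 : x - (h + h) + h + h = x := by abel
  have e6 : x - (h + h) + h = x - h := by abel
  rw [e1, e2, e3, e4, e5, e6]
  simp only [smul_eq_mul]
  ring

theorem abs_symmDiff2_sub_hess_le {g : E → ℝ} (hg : ContDiff ℝ 2 g) {α N : ℝ} (hα : 0 < α)
    (hN : ∀ x h, |(fwdDiff h)^[3] g x| ≤ N * ‖h‖ ^ (2 + α)) (x h : E) :
    |symmDiff2 h g x - hess g x h h| ≤ N * ‖h‖ ^ (2 + α) / (1 - (2 : ℝ) ^ (-α)) := by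
  set p : ℝ := (2 : ℝ) ^ (-α)
  have hp0 : 0 < p := by positivity
  have hp1 : p < 1 := Real.rpow_lt_one_of_one_lt_of_neg one_lt_two (by linarith)
  set a : ℕ → ℝ := fun n => 4 ^ n * symmDiff2 ((2 : ℝ)⁻¹ ^ n • h) g x
  have ha : Filter.Tendsto a Filter.atTop (nhds (hess g x h h)) := by
    have h1 : Filter.Tendsto (fun n : ℕ => (2 : ℝ)⁻¹ ^ n) Filter.atTop (nhdsWithin 0 {0}ᶜ) :=
      tendsto_nhdsWithin_iff.2 ⟨tendsto_pow_atTop_nhds_zero_of_lt_one (by norm_num) (by norm_num),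
        .of_forall fun n => by simp⟩
    refine ((tendsto_symmDiff2_div hg x h).comp h1).congr fun n => ?_
    simp only [Function.comp_apply, a]
    rw [div_eq_inv_mul]
    congr 1
    rw [← pow_mul, mul_comm n 2, pow_mul, ← inv_pow]; norm_num
  have hstep (n : ℕ) : dist (a n) (a (n + 1)) ≤ N * ‖h‖ ^ (2 + α) * p ^ n := by
    set k : E := (2 : ℝ)⁻¹ ^ (n + 1) • h
    have hk : (2 : ℝ)⁻¹ ^ n • h = k + k := by
      rw [← two_smul ℝ k, smul_smul, pow_succ']; simp
    have h1 : a n - a (n + 1) =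
        4 ^ n * ((fwdDiff k)^[3] g (x - k) - (fwdDiff k)^[3] g (x - (k + k))) := by
      rw [← symmDiff2_double]; simp only [a, hk, pow_succ, k]; ring
    have hkn : ‖k‖ ^ (2 + α) = 4⁻¹ * p * (4 ^ n)⁻¹ * p ^ n * ‖h‖ ^ (2 + α) := by
      rw [norm_smul, norm_pow, norm_inv, Real.norm_ofNat, Real.mul_rpow (by positivity)
        (norm_nonneg h)]
      congr 1
      have h2 : ((2 : ℝ)⁻¹) ^ (2 + α) = 4⁻¹ * p := by
        rw [Real.rpow_add (by positivity), Real.inv_rpow two_pos.le, Real.inv_rpow two_pos.le,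
          ← Real.rpow_neg two_pos.le α]
        norm_num [p]
      rw [← Real.rpow_natCast, ← Real.rpow_mul (by positivity), mul_comm, Real.rpow_mul
        (by positivity), h2, Real.rpow_natCast, pow_succ, mul_pow, inv_pow]
      ring
    rw [Real.dist_eq, h1, abs_mul, abs_of_nonneg (by positivity)]
    have hA : 0 ≤ N * ‖h‖ ^ (2 + α) := (abs_nonneg _).trans (hN x h)
    calc (4 : ℝ) ^ n * |(fwdDiff k)^[3] g (x - k) - (fwdDiff k)^[3] g (x - (k + k))|
        ≤ 4 ^ n * (N * ‖k‖ ^ (2 + α) + N * ‖k‖ ^ (2 + α)) := by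
          gcongr; exact (abs_sub _ _).trans (add_le_add (hN _ _) (hN _ _))
      _ = (N * ‖h‖ ^ (2 + α) * p ^ n) * (p / 2) := by rw [hkn]; field_simp; ring
      _ ≤ (N * ‖h‖ ^ (2 + α) * p ^ n) * 1 := by gcongr; linarith
      _ = _ := mul_one _
  have := dist_le_of_le_geometric_of_tendsto₀ p _ hp1 hstep ha
  simpa [Real.dist_eq, a] using this

theorem abs_hess_le_of_thirdDiff {g : E → ℝ} (hg : ContDiff ℝ 2 g) {α N U : ℝ} (hα : 0 < α)
    (hN : ∀ x h, |(fwdDiff h)^[3] g x| ≤ N * ‖h‖ ^ (2 + α)) (hU : ∀ x, |g x| ≤ U)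
    {ρ : ℝ} (hρ : 0 < ρ) (x : E) {b : E} (hb : ‖b‖ = 1) :
    |hess g x b b| ≤ N * ρ ^ α / (1 - (2 : ℝ) ^ (-α)) + 4 * U / ρ ^ 2 := by
  have h1 := abs_symmDiff2_sub_hess_le hg hα hN x (ρ • b)
  have h2 : |symmDiff2 (ρ • b) g x| ≤ 4 * U := by
    have a1 := abs_le.1 (hU (x + ρ • b))
    have a2 := abs_le.1 (hU (x - ρ • b))
    have a3 := abs_le.1 (hU x)
    rw [symmDiff2, abs_le]
    constructor <;> linarith
  have h3 : hess g x (ρ • b) (ρ • b) = ρ ^ 2 * hess g x b b := by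
    simp only [map_smul, smul_apply, smul_eq_mul]; ring
  rw [h3, norm_smul, hb, mul_one, Real.norm_of_nonneg hρ.le, Real.rpow_add hρ, Real.rpow_two] at h1
  have h4 : ρ ^ 2 * |hess g x b b| ≤ 4 * U + N * (ρ ^ 2 * ρ ^ α) / (1 - (2 : ℝ) ^ (-α)) := by
    have : ρ ^ 2 * |hess g x b b| = |ρ ^ 2 * hess g x b b| := by
      rw [abs_mul, abs_of_nonneg (by positivity : 0 ≤ ρ ^ 2)]
    rw [this]
    have := abs_sub_abs_le_abs_sub (ρ ^ 2 * hess g x b b) (symmDiff2 (ρ • b) g x)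
    rw [abs_sub_comm] at this
    linarith
  have hρ2 : 0 < ρ ^ 2 := by positivity
  refine le_of_mul_le_mul_left (h4.trans (le_of_eq ?_)) hρ2
  field_simp
  ring

end

/-- The sign `±1` attached to a Boolean. -/
def boolSign (b : Bool) : ℝ := if b then 1 else -1

theorem abs_boolSign (b : Bool) : |boolSign b| = 1 := by cases b <;> simp [boolSign]

theorem boolSign_not (b : Bool) : boolSign (!b) = -boolSign b := by cases b <;> simp [boolSign]

/-- The product of the three signs. -/
def cubeSign (ε : Fin 3 → Bool) : ℝ := ∏ i, boolSign (ε i)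

theorem abs_cubeSign (ε : Fin 3 → Bool) : |cubeSign ε| = 1 := by
  simp [cubeSign, Finset.abs_prod, abs_boolSign]

/-- The vertex `∑ ± h_i` of the cube. -/
def cubeShift (ε : Fin 3 → Bool) (h : Fin 3 → ℝ) : ℝ := ∑ i, boolSign (ε i) * h i

theorem cubeShift_update (ε : Fin 3 → Bool) (h : Fin 3 → ℝ) (i : Fin 3) (k : ℝ) :
    cubeShift ε (Function.update h i (h i + k)) = cubeShift ε h + boolSign (ε i) * k := by
  have : ∀ j, boolSign (ε j) * Function.update h i (h i + k) j =
      boolSign (ε j) * h j + if j = i then boolSign (ε i) * k else 0 := fun j => by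
    by_cases hj : j = i
    · subst hj; simp; ring
    · simp [hj]
  simp [cubeShift, this, Finset.sum_add_distrib]

theorem abs_cubeShift_le (ε : Fin 3 → Bool) {h : Fin 3 → ℝ} {M : ℝ} (hh : ∀ i, |h i| ≤ M) :
    |cubeShift ε h| ≤ 3 * M := by
  refine (Finset.abs_sum_le_sum_abs _ _).trans ?_
  calc ∑ i, |boolSign (ε i) * h i| ≤ ∑ _i : Fin 3, M :=
        Finset.sum_le_sum fun i _ => by rw [abs_mul, abs_boolSign, one_mul]; exact hh i
    _ = 3 * M := by simp

theorem abs_sum_cubeSign_mul_le {c : (Fin 3 → Bool) → ℝ} {M : ℝ} (hc : ∀ ε, |c ε| ≤ M) :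
    |∑ ε, cubeSign ε * c ε| ≤ 8 * M := by
  refine (Finset.abs_sum_le_sum_abs _ _).trans ?_
  calc ∑ ε, |cubeSign ε * c ε| ≤ ∑ _ε : Fin 3 → Bool, M :=
        Finset.sum_le_sum fun ε _ => by rw [abs_mul, abs_cubeSign, one_mul]; exact hc ε
    _ = 8 * M := by simp

theorem sum_cubeSign_mul_eq_zero (i : Fin 3) {c : (Fin 3 → Bool) → ℝ}
    (hc : ∀ ε, c (Function.update ε i (!ε i)) = c ε) : ∑ ε, cubeSign ε * c ε = 0 := by
  have hs (ε : Fin 3 → Bool) : cubeSign (Function.update ε i (!ε i)) = -cubeSign ε := by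
    rw [cubeSign, cubeSign, ← Finset.mul_prod_erase _ _ (Finset.mem_univ i),
      ← Finset.mul_prod_erase Finset.univ (fun j => boolSign (ε j)) (Finset.mem_univ i),
      Function.update_self, boolSign_not, neg_mul]
    congr 2
    exact Finset.prod_congr rfl fun j hj => by
      rw [Function.update_of_ne (Finset.ne_of_mem_erase hj)]
  refine Finset.sum_involution (fun ε _ => Function.update ε i (!ε i)) (fun ε _ => ?_)
    (fun ε _ _ h => ?_) (fun _ _ => Finset.mem_univ _) (fun ε _ => ?_)
  · rw [hc, hs]; ring
  · have := congrFun h i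
    simp at this
  · simp

theorem sum_cubeSign : ∑ ε, cubeSign ε = 0 := by
  simpa using sum_cubeSign_mul_eq_zero 0 (c := fun _ => 1) fun _ => rfl

section

variable {E : Type*} [NormedAddCommGroup E] [NormedSpace ℝ E]

/-- The third symmetric difference of `g` at `x` in direction `e` with steps `2 h_i`. -/
def cubeDiff (e : E) (g : E → ℝ) (x : E) (h : Fin 3 → ℝ) : ℝ :=
  ∑ ε, cubeSign ε * g (x + cubeShift ε h • e)

theorem cubeDiff_eq_zero (e : E) (g : E → ℝ) (x : E) {h : Fin 3 → ℝ} {i : Fin 3} (hi : h i = 0) :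
    cubeDiff e g x h = 0 := by
  refine sum_cubeSign_mul_eq_zero i fun ε => ?_
  congr 3
  refine Finset.sum_congr rfl fun j _ => ?_
  by_cases hj : j = i
  · subst hj; simp [hi]
  · rw [Function.update_of_ne hj]

theorem symmDiff2_cubeDiff (e : E) (g : E → ℝ) (x b : E) (h : Fin 3 → ℝ) :
    symmDiff2 b (fun y => cubeDiff e g y h) x =
      ∑ ε, cubeSign ε * symmDiff2 b g (x + cubeShift ε h • e) := by
  simp only [symmDiff2, cubeDiff, Finset.mul_sum, ← Finset.sum_add_distrib,
    ← Finset.sum_sub_distrib]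
  refine Finset.sum_congr rfl fun ε _ => ?_
  rw [add_right_comm x b, sub_add_eq_add_sub]
  ring

theorem cubeDiff_update (e : E) (g : E → ℝ) (x : E) (h : Fin 3 → ℝ) (i : Fin 3) (k : ℝ) :
    cubeDiff e g x (Function.update h i (h i + k)) + cubeDiff e g x (Function.update h i (h i - k)) -
      2 * cubeDiff e g x h = ∑ ε, cubeSign ε * symmDiff2 (k • e) g (x + cubeShift ε h • e) := by
  simp only [symmDiff2, cubeDiff, Finset.mul_sum, ← Finset.sum_add_distrib,
    ← Finset.sum_sub_distrib]
  refine Finset.sum_congr rfl fun ε _ => ?_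
  rw [sub_eq_add_neg (h i), cubeShift_update, cubeShift_update]
  have e1 : x + (cubeShift ε h + k) • e = x + cubeShift ε h • e + k • e := by module
  have e2 : x + (cubeShift ε h + -k) • e = x + cubeShift ε h • e - k • e := by module
  cases ε i
  · simp only [boolSign, Bool.false_eq_true, ↓reduceIte, neg_mul, one_mul, mul_neg, neg_neg, e1, e2]
    ring
  · simp only [boolSign, ↓reduceIte, one_mul, e1, e2]
    ring

theorem cubeDiff_neg (e : E) (g : E → ℝ) (x : E) (h : Fin 3 → ℝ) :
    cubeDiff (-e) g x h = -cubeDiff e g x h := by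
  have hs (ε : Fin 3 → Bool) : cubeSign (fun i => !ε i) = -cubeSign ε := by
    simp only [cubeSign, boolSign_not, Fin.prod_univ_three]
    ring
  have ht (ε : Fin 3 → Bool) : cubeShift (fun i => !ε i) h = -cubeShift ε h := by
    simp [cubeShift, boolSign_not]
  have hinv : Function.Involutive fun (ε : Fin 3 → Bool) (i : Fin 3) => !ε i := fun ε => by simp
  rw [cubeDiff, cubeDiff, ← Finset.sum_neg_distrib, ← Equiv.sum_comp hinv.toPerm]
  refine Finset.sum_congr rfl fun ε _ => ?_
  change cubeSign (fun i => !ε i) * g (x + cubeShift (fun i => !ε i) h • -e) = _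
  rw [hs, ht, smul_neg, neg_smul, neg_neg, neg_mul]

theorem fwdDiff_iter_three_eq_cubeDiff (e : E) (g : E → ℝ) (x : E) (k : ℝ) :
    (fwdDiff (k • e))^[3] g x = cubeDiff e g (x + (3 * k / 2) • e) fun _ => k / 2 := by
  have hu : (Finset.univ : Finset (Fin 3 → Bool)) =
      {![true, true, true], ![true, true, false], ![true, false, true], ![true, false, false],
       ![false, true, true], ![false, true, false], ![false, false, true],
       ![false, false, false]} := by decide
  rw [fwdDiff_iter_three (F := ℝ), cubeDiff, hu]
  repeat rw [Finset.sum_insert (by decide)]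
  rw [Finset.sum_singleton]
  have e3 : x + k • e + k • e + k • e = x + (3 * k) • e := by module
  have e2 : x + k • e + k • e = x + (2 * k) • e := by module
  rw [e3, e2]
  have f3 (s : ℝ) : x + (3 * k / 2) • e + s • e = x + (3 * k / 2 + s) • e := by module
  simp only [cubeSign, cubeShift, boolSign, Fin.prod_univ_three, Fin.sum_univ_three, f3]
  simp
  have r0 : 3 * k / 2 + (k + k / 2) = 3 * k := by ring
  have r1 : 3 * k / 2 + k / 2 = 2 * k := by ring
  have r2 : 3 * k / 2 + -(k / 2) = k := by ring
  have r3 : 3 * k / 2 + (-(k / 2) + -(k / 2) + -(k / 2)) = 0 := by ring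
  have r4 : 3 * k / 2 + (k + -(k / 2)) = 2 * k := by ring
  simp only [r0, r1, r2, r3, r4, zero_smul, add_zero]
  ring

end

/-- Testing an elliptic matrix against a bilinear form that is bounded above and has a small value in
one direction. -/
theorem sum_elliptic_mul_le {d : ℕ} {A : Matrix (Fin d) (Fin d) ℝ} {c₀ : ℝ} (hc₀ : 0 < c₀)
    (hA : A.IsSymm)
    (hell : ∀ ξ : RSpace d, c₀⁻¹ * ‖ξ‖ ^ 2 ≤ ∑ i, ∑ j, A i j * ξ i * ξ j ∧
      ∑ i, ∑ j, A i j * ξ i * ξ j ≤ c₀ * ‖ξ‖ ^ 2)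
    (B : RSpace d →L[ℝ] RSpace d →L[ℝ] ℝ) {lam μ : ℝ} (hlam : 0 ≤ lam)
    (hB : ∀ b, B b b ≤ lam * ‖b‖ ^ 2) {e : RSpace d} (he : ‖e‖ = 1) (hμ : B e e ≤ μ) :
    ∑ i, ∑ j, A i j * B (EuclideanSpace.single i 1) (EuclideanSpace.single j 1) ≤
      c₀⁻¹ * μ + c₀ * d * lam := by
  set P : Matrix (Fin d) (Fin d) ℝ := A - c₀⁻¹ • Matrix.vecMulVec e e
  have hP : P.PosSemidef := by
    refine Matrix.posSemidef_iff_dotProduct_mulVec.2 ⟨?_, fun x => ?_⟩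
    · rw [Matrix.IsHermitian, Matrix.conjTranspose_eq_transpose_of_trivial]
      ext i j
      have := hA.apply i j
      simp [P, Matrix.vecMulVec_apply, this, mul_comm]
    · set ξ : RSpace d := WithLp.toLp 2 x
      have h1 := (hell ξ).1
      have h2 : |inner ℝ e ξ| ≤ ‖ξ‖ := by simpa [he] using abs_real_inner_le_norm e ξ
      have h3 : inner ℝ e ξ = ∑ i, e i * x i := by simp [PiLp.inner_apply, ξ, mul_comm]
      have h4 : star x ⬝ᵥ P.mulVec x =
          ∑ i, ∑ j, A i j * ξ i * ξ j - c₀⁻¹ * (inner ℝ e ξ) ^ 2 := by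
        rw [h3, sq, Finset.sum_mul_sum, Finset.mul_sum, ← Finset.sum_sub_distrib]
        simp only [dotProduct, Matrix.mulVec, Finset.mul_sum, ← Finset.sum_sub_distrib]
        refine Finset.sum_congr rfl fun i _ => Finset.sum_congr rfl fun j _ => ?_
        simp [P, Matrix.vecMulVec_apply, ξ]
        ring
      have h5 : c₀⁻¹ * (inner ℝ e ξ) ^ 2 ≤ c₀⁻¹ * ‖ξ‖ ^ 2 := by
        rw [← sq_abs (inner ℝ e ξ)]; gcongr
      rw [h4]; linarith
  obtain ⟨m, v, hv⟩ := Matrix.posSemidef_iff_eq_sum_vecMulVec.1 hP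
  have hsum (V : RSpace d) : ∑ i, V i • EuclideanSpace.single i (1 : ℝ) = V := by
    ext j
    simp [Finset.sum_apply, Pi.single_apply]
  have hexp (V W : RSpace d) : ∑ i, ∑ j, V i * W j *
      B (EuclideanSpace.single i 1) (EuclideanSpace.single j 1) = B V W := by
    nth_rewrite 2 [← hsum V]
    nth_rewrite 2 [← hsum W]
    simp only [map_sum, map_smul, sum_apply, smul_apply, smul_eq_mul, Finset.mul_sum]
    rw [Finset.sum_comm]
    exact Finset.sum_congr rfl fun i _ => Finset.sum_congr rfl fun j _ => by ring
  have hAP (i j : Fin d) : A i j = (∑ k, v k i * v k j) + c₀⁻¹ * (e i * e j) := by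
    have h1 : P i j = ∑ k, v k i * v k j := by
      rw [hv, Matrix.sum_apply]; simp [Matrix.vecMulVec_apply]
    rw [← h1]; simp [P, Matrix.vecMulVec_apply]
  have htr : ∑ k, ‖(WithLp.toLp 2 (v k) : RSpace d)‖ ^ 2 ≤ c₀ * d := by
    have h1 : ∑ i, A i i ≤ c₀ * d := by
      calc ∑ i, A i i ≤ ∑ _i : Fin d, c₀ := Finset.sum_le_sum fun i _ => by
            have := (hell (EuclideanSpace.single i 1)).2
            simpa [Pi.single_apply] using this
        _ = c₀ * d := by simp [mul_comm]
    refine le_trans ?_ h1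
    simp_rw [EuclideanSpace.norm_sq_eq, Real.norm_eq_abs, sq_abs]
    rw [Finset.sum_comm]
    refine Finset.sum_le_sum fun i _ => ?_
    rw [hAP i i]
    have : 0 ≤ c₀⁻¹ * (e i * e i) := mul_nonneg (by positivity) (mul_self_nonneg _)
    simp only [sq]
    linarith
  have hkey : ∑ i, ∑ j, A i j * B (EuclideanSpace.single i 1) (EuclideanSpace.single j 1) =
      ∑ k, B (WithLp.toLp 2 (v k)) (WithLp.toLp 2 (v k)) + c₀⁻¹ * B e e := by
    have p1 : ∑ k, B (WithLp.toLp 2 (v k)) (WithLp.toLp 2 (v k)) = ∑ i, ∑ j, ∑ k, v k i * v k j *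
        B (EuclideanSpace.single i 1) (EuclideanSpace.single j 1) := by
      rw [Finset.sum_congr rfl fun k _ => (hexp _ _).symm, Finset.sum_comm]
      exact Finset.sum_congr rfl fun i _ => Finset.sum_comm
    rw [p1, ← hexp e e, Finset.mul_sum, ← Finset.sum_add_distrib]
    refine Finset.sum_congr rfl fun i _ => ?_
    rw [Finset.mul_sum, ← Finset.sum_add_distrib]
    refine Finset.sum_congr rfl fun j _ => ?_
    rw [hAP, add_mul, Finset.sum_mul]
    ring
  rw [hkey]
  have h6 : ∑ k, B (WithLp.toLp 2 (v k)) (WithLp.toLp 2 (v k)) ≤ c₀ * d * lam := by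
    calc _ ≤ ∑ k, lam * ‖(WithLp.toLp 2 (v k) : RSpace d)‖ ^ 2 := Finset.sum_le_sum fun k _ => hB _
      _ = lam * ∑ k, ‖(WithLp.toLp 2 (v k) : RSpace d)‖ ^ 2 := by rw [Finset.mul_sum]
      _ ≤ lam * (c₀ * d) := by gcongr
      _ = _ := by ring
  have h7 : c₀⁻¹ * B e e ≤ c₀⁻¹ * μ := by gcongr
  linarith

/-- A quantitative form of the concavity of `x ↦ x ^ γ` for `γ ∈ [0, 1]`. -/
theorem rpow_add_rpow_sub_le {γ : ℝ} (h0 : 0 ≤ γ) (h1 : γ ≤ 1) {s k : ℝ} (hs : 0 < s)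
    (hk0 : 0 ≤ k) (hks : k ≤ s) :
    (s + k) ^ γ + (s - k) ^ γ - 2 * s ^ γ ≤ -(γ * (1 - γ) / 2) * s ^ (γ - 2) * k ^ 2 := by
  have key : ∀ y ∈ Icc (0 : ℝ) 1, (1 + y) ^ γ + (1 - y) ^ γ + γ * (1 - γ) / 2 * y ^ 2 ≤ 2 := by
    set ψ : ℝ → ℝ := fun y => (1 + y) ^ γ + (1 - y) ^ γ + γ * (1 - γ) / 2 * y ^ 2
    have hanti : AntitoneOn ψ (Icc 0 1) := by
      refine antitoneOn_of_hasDerivWithinAt_nonpos (f' := fun y => γ * (1 + y) ^ (γ - 1) -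
        γ * (1 - y) ^ (γ - 1) + γ * (1 - γ) * y) (convex_Icc 0 1) ?_ ?_ ?_
      · refine ContinuousOn.add (ContinuousOn.add ?_ ?_) (by fun_prop)
        · exact ContinuousOn.rpow_const (by fun_prop) fun y hy => Or.inr h0
        · exact ContinuousOn.rpow_const (by fun_prop) fun y hy => Or.inr h0
      · intro y hy
        rw [interior_Icc] at hy
        refine HasDerivAt.hasDerivWithinAt ?_
        have a1 := ((hasDerivAt_id y).const_add 1).rpow_const (p := γ)
          (Or.inl (by simp only [id]; linarith [hy.1]))
        have a2 := ((hasDerivAt_id y).const_sub 1).rpow_const (p := γ)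
          (Or.inl (by simp only [id]; linarith [hy.2]))
        have a3 := (hasDerivAt_pow 2 y).const_mul (γ * (1 - γ) / 2)
        refine ((a1.add a2).add a3).congr_deriv ?_
        simp only [id]
        push_cast
        ring
      · intro y hy
        rw [interior_Icc] at hy
        have b1 : (1 + y) ^ (γ - 1) ≤ 1 :=
          Real.rpow_le_one_of_one_le_of_nonpos (by linarith [hy.1]) (by linarith)
        have b2 : 1 + (1 - γ) * y ≤ (1 - y) ^ (γ - 1) := by
          have c1 : (1 - y) ^ (1 - γ) ≤ 1 + (1 - γ) * (-y) := by
            rw [sub_eq_add_neg 1 y]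
            exact rpow_one_add_le_one_add_mul_self (by linarith [hy.2]) (by linarith) (by linarith)
          have c2 : 0 < (1 - y) ^ (1 - γ) := Real.rpow_pos_of_pos (by linarith [hy.2]) _
          have c3 : (1 - y) ^ (γ - 1) = ((1 - y) ^ (1 - γ))⁻¹ := by
            rw [← Real.rpow_neg (by linarith [hy.2])]; congr 1; ring
          rw [c3, le_inv_comm₀ (by nlinarith [hy.1]) c2]
          refine c1.trans ?_
          rw [← one_div, le_div_iff₀ (by nlinarith [hy.1])]
          nlinarith [sq_nonneg ((1 - γ) * y)]
        nlinarith [mul_le_mul_of_nonneg_left b1 h0, mul_le_mul_of_nonneg_left b2 h0]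
    intro y hy
    have := hanti (left_mem_Icc.2 zero_le_one) hy hy.1
    simp only [ψ] at this
    norm_num at this
    linarith
  have h2 := key (k / s) ⟨by positivity, (div_le_one hs).2 hks⟩
  have e1 : s + k = s * (1 + k / s) := by field_simp
  have e2 : s - k = s * (1 - k / s) := by field_simp
  have hk1 : k / s ≤ 1 := (div_le_one hs).2 hks
  rw [e1, e2, Real.mul_rpow hs.le (by positivity), Real.mul_rpow hs.le (by linarith),
    Real.rpow_sub hs, Real.rpow_two]
  have h3 : 0 < s ^ γ := Real.rpow_pos_of_pos hs _
  have h4 := mul_le_mul_of_nonneg_left h2 h3.le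
  have e3 : s ^ γ * (γ * (1 - γ) / 2 * (k / s) ^ 2) =
      γ * (1 - γ) / 2 * (s ^ γ / s ^ 2) * k ^ 2 := by field_simp
  linarith

/-- The barrier `∏ h_i ^ γ`. -/
def barrier (γ : ℝ) (h : Fin 3 → ℝ) : ℝ := ∏ i, h i ^ γ

theorem barrier_nonneg {γ : ℝ} {h : Fin 3 → ℝ} (hh : ∀ i, 0 ≤ h i) : 0 ≤ barrier γ h :=
  Finset.prod_nonneg fun i _ => Real.rpow_nonneg (hh i) _

theorem barrier_update (γ : ℝ) (h : Fin 3 → ℝ) (i : Fin 3) (s : ℝ) :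
    barrier γ (Function.update h i s) = s ^ γ * ∏ j ∈ Finset.univ.erase i, h j ^ γ := by
  rw [barrier, ← Finset.mul_prod_erase _ _ (Finset.mem_univ i), Function.update_self]
  congr 1
  exact Finset.prod_congr rfl fun j hj => by rw [Function.update_of_ne (Finset.ne_of_mem_erase hj)]

/-- In the direction of the smallest variable the barrier is concave enough. -/
theorem barrier_symmDiff_le {β γ : ℝ} (hγ : 3 * γ = 2 + β) (h0 : 0 ≤ γ) (h1 : γ ≤ 1)
    {h : Fin 3 → ℝ} (hh : ∀ i, 0 < h i) {i : Fin 3} (hi : ∀ j, h i ≤ h j) (m : Fin 3) {k : ℝ}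
    (hk0 : 0 ≤ k) (hk : k ≤ h i) :
    barrier γ (Function.update h i (h i + k)) + barrier γ (Function.update h i (h i - k)) -
      2 * barrier γ h ≤ -(γ * (1 - γ) / 2) * h m ^ β * k ^ 2 := by
  have e0 : barrier γ h = h i ^ γ * ∏ j ∈ Finset.univ.erase i, h j ^ γ := by
    rw [← barrier_update, Function.update_eq_self]
  set Q := ∏ j ∈ Finset.univ.erase i, h j ^ γ
  have hQ : 0 ≤ Q := Finset.prod_nonneg fun j _ => Real.rpow_nonneg (hh j).le _
  have hlow : h m ^ β ≤ h i ^ (γ - 2) * Q := by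
    have f1 : h m ^ γ * (h i ^ γ) ^ 2 ≤ h i ^ γ * Q := by
      rw [← e0, barrier, ← Finset.mul_prod_erase _ _ (Finset.mem_univ m)]
      refine mul_le_mul_of_nonneg_left ?_ (Real.rpow_nonneg (hh m).le _)
      have : (h i ^ γ) ^ 2 = ∏ _j ∈ Finset.univ.erase m, h i ^ γ := by
        rw [Finset.prod_const, Finset.card_erase_of_mem (Finset.mem_univ m)]; rfl
      rw [this]
      exact Finset.prod_le_prod (fun _ _ => Real.rpow_nonneg (hh i).le _) fun j _ =>
        Real.rpow_le_rpow (hh i).le (hi j) h0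
    have f2 : h i ^ (γ - 2) * Q = h i ^ (-2 : ℝ) * (h i ^ γ * Q) := by
      rw [← mul_assoc, ← Real.rpow_add (hh i)]; congr 2; ring
    have f3 : h i ^ (-2 : ℝ) * (h m ^ γ * (h i ^ γ) ^ 2) = h m ^ γ * h i ^ (2 * γ - 2) := by
      rw [mul_left_comm, ← Real.rpow_natCast, ← Real.rpow_mul (hh i).le, ← Real.rpow_add (hh i)]
      congr 2; push_cast; ring
    have f4 : h m ^ β = h m ^ γ * h m ^ (2 * γ - 2) := by
      rw [← Real.rpow_add (hh m)]; congr 1; linarith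
    have f5 : h m ^ (2 * γ - 2) ≤ h i ^ (2 * γ - 2) :=
      Real.rpow_le_rpow_of_nonpos (hh i) (hi m) (by linarith)
    rw [f2, f4]
    calc _ ≤ h m ^ γ * h i ^ (2 * γ - 2) :=
          mul_le_mul_of_nonneg_left f5 (Real.rpow_nonneg (hh m).le _)
      _ = _ := f3.symm
      _ ≤ _ := mul_le_mul_of_nonneg_left f1 (Real.rpow_nonneg (hh i).le _)
  have h2 := mul_le_mul_of_nonneg_right (rpow_add_rpow_sub_le h0 h1 (hh i) hk0 hk) hQ
  rw [barrier_update, barrier_update, e0]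
  have h3 : (γ * (1 - γ) / 2 * k ^ 2) * h m ^ β ≤ (γ * (1 - γ) / 2 * k ^ 2) * (h i ^ (γ - 2) * Q) :=
    mul_le_mul_of_nonneg_left hlow (by have := mul_nonneg h0 (sub_nonneg.2 h1); positivity)
  linarith

/-- A time slice `g` of a solution with time derivative `w`, coefficients `A` and source `f`,
together with bounds for its derivatives and differences. -/
structure RegularSlice {d : ℕ} (β α D F N : ℝ) (A : RSpace d → Matrix (Fin d) (Fin d) ℝ)
    (g w f : RSpace d → ℝ) : Prop where
  contDiff : ContDiff ℝ 2 g
  hess_le : ∀ x i j, |hess g x (EuclideanSpace.single i 1) (EuclideanSpace.single j 1)| ≤ D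
  third : ∀ x h, |(fwdDiff h)^[3] g x| ≤ N * ‖h‖ ^ (2 + α)
  holder : ∀ x y, |f x - f y| ≤ F * ‖x - y‖ ^ β
  eq : ∀ x, w x = ∑ i, ∑ j, A x i j *
    hess g x (EuclideanSpace.single i 1) (EuclideanSpace.single j 1) + f x

theorem IsHolderElliptic.abs_sub_le {d : ℕ} {c₀ β : ℝ} {a : ℝ → RSpace d → Matrix (Fin d) (Fin d) ℝ}
    (ha : IsHolderElliptic c₀ β a) {t : ℝ} (ht : 0 ≤ t) (x y : RSpace d) (i j : Fin d) :
    |a t x i j - a t y i j| ≤ c₀ * ‖x - y‖ ^ β := by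
  refine le_trans (Real.abs_le_sqrt ?_) (ha.holder t ht x y)
  calc (a t x i j - a t y i j) ^ 2 ≤ ∑ j, (a t x i j - a t y i j) ^ 2 :=
        Finset.single_le_sum (f := fun j => (a t x i j - a t y i j) ^ 2)
          (fun _ _ => sq_nonneg _) (Finset.mem_univ j)
    _ ≤ _ := Finset.single_le_sum (f := fun i => ∑ j, (a t x i j - a t y i j) ^ 2)
          (fun _ _ => Finset.sum_nonneg fun _ _ => sq_nonneg _) (Finset.mem_univ i)

/-- The third difference of the time derivative, when the third difference of the Hessian is
bounded above. -/
theorem RegularSlice.sum_le {d : ℕ} {c₀ β α D F N : ℝ} (hβ : β ∈ Ioo (0 : ℝ) 1) (hc₀ : 0 < c₀)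
    {a : ℝ → RSpace d → Matrix (Fin d) (Fin d) ℝ} (ha : IsHolderElliptic c₀ β a) {t : ℝ}
    (ht : 0 ≤ t) {g w f : RSpace d → ℝ} (hs : RegularSlice β α D F N (a t) g w f)
    (hF : 0 ≤ F) {e : RSpace d} (he : ‖e‖ = 1) (x : RSpace d) {h : Fin 3 → ℝ} {M : ℝ}
    (hM0 : 0 ≤ M) (hM : ∀ i, |h i| ≤ M) {lam μ : ℝ} (hlam : 0 ≤ lam)
    (hb : ∀ b, ∑ ε, cubeSign ε * hess g (x + cubeShift ε h • e) b b ≤ lam * ‖b‖ ^ 2)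
    (hμ : ∑ ε, cubeSign ε * hess g (x + cubeShift ε h • e) e e ≤ μ) :
    ∑ ε, cubeSign ε * w (x + cubeShift ε h • e) ≤
      c₀⁻¹ * μ + c₀ * d * lam + 24 * (c₀ * d ^ 2 * D + F) * M ^ β := by
  set y : (Fin 3 → Bool) → RSpace d := fun ε => x + cubeShift ε h • e
  set B : RSpace d →L[ℝ] RSpace d →L[ℝ] ℝ := ∑ ε, cubeSign ε • hess g (y ε)
  have hB (b b' : RSpace d) : B b b' = ∑ ε, cubeSign ε * hess g (y ε) b b' := by
    simp [B, sum_apply]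
  set E : Fin d → RSpace d := fun i => EuclideanSpace.single i 1
  have h1 := sum_elliptic_mul_le hc₀ (ha.symm t ht x) (ha.elliptic t ht x) B hlam
    (fun b => (hB b b).trans_le (hb b)) he ((hB e e).trans_le hμ)
  set R : (Fin 3 → Bool) → ℝ := fun ε =>
    (∑ i, ∑ j, (a t (y ε) i j - a t x i j) * hess g (y ε) (E i) (E j)) + (f (y ε) - f x)
  have hw (ε) : w (y ε) = ∑ i, ∑ j, a t x i j * hess g (y ε) (E i) (E j) + R ε + f x := by
    rw [hs.eq]
    simp only [R, sub_mul, Finset.sum_sub_distrib, E]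
    ring
  have hdist (ε) : ‖y ε - x‖ ^ β ≤ 3 * M ^ β := by
    have : ‖y ε - x‖ ≤ 3 * M := by
      simp only [y, add_sub_cancel_left, norm_smul, he, mul_one, Real.norm_eq_abs]
      exact abs_cubeShift_le ε hM
    calc ‖y ε - x‖ ^ β ≤ (3 * M) ^ β := Real.rpow_le_rpow (norm_nonneg _) this hβ.1.le
      _ = 3 ^ β * M ^ β := Real.mul_rpow (by norm_num) hM0
      _ ≤ 3 ^ (1 : ℝ) * M ^ β := by
          gcongr
          · norm_num
          · exact hβ.2.le
      _ = 3 * M ^ β := by rw [Real.rpow_one]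
  have hR (ε) : |R ε| ≤ (c₀ * d ^ 2 * D + F) * (3 * M ^ β) := by
    have r1 : |∑ i, ∑ j, (a t (y ε) i j - a t x i j) * hess g (y ε) (E i) (E j)| ≤
        ∑ _i : Fin d, ∑ _j : Fin d, c₀ * (3 * M ^ β) * D := by
      refine (Finset.abs_sum_le_sum_abs _ _).trans (Finset.sum_le_sum fun i _ =>
        (Finset.abs_sum_le_sum_abs _ _).trans (Finset.sum_le_sum fun j _ => ?_))
      rw [abs_mul]
      have h2 := (ha.abs_sub_le ht (y ε) x i j).trans
        (mul_le_mul_of_nonneg_left (hdist ε) hc₀.le)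
      exact mul_le_mul h2 (hs.hess_le _ i j) (abs_nonneg _) ((abs_nonneg _).trans h2)
    have r2 : |f (y ε) - f x| ≤ F * (3 * M ^ β) :=
      (hs.holder _ _).trans (mul_le_mul_of_nonneg_left (hdist ε) hF)
    refine (abs_add_le _ _).trans ((add_le_add r1 r2).trans (le_of_eq ?_))
    simp only [Finset.sum_const, Finset.card_univ, Fintype.card_fin, nsmul_eq_mul]
    ring
  have h3 := (le_abs_self _).trans (abs_sum_cubeSign_mul_le hR)
  have h4 : ∑ ε, cubeSign ε * w (y ε) = ∑ i, ∑ j, a t x i j * B (E i) (E j) +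
      ∑ ε, cubeSign ε * R ε := by
    have : ∑ ε, cubeSign ε * ∑ i, ∑ j, a t x i j * hess g (y ε) (E i) (E j) =
        ∑ i, ∑ j, a t x i j * B (E i) (E j) := by
      simp only [hB, Finset.mul_sum]
      rw [Finset.sum_comm]
      refine Finset.sum_congr rfl fun i _ => ?_
      rw [Finset.sum_comm]
      exact Finset.sum_congr rfl fun j _ => Finset.sum_congr rfl fun ε _ => by ring
    simp only [hw, mul_add, Finset.sum_add_distrib, this, ← Finset.sum_mul, sum_cubeSign, zero_mul,
      add_zero]
  rw [h4]
  change ∑ i, ∑ j, a t x i j * B (E i) (E j) ≤ _ at h1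
  linarith

section

variable {d : ℕ} {T : ℝ} {u v : ℝ → RSpace d → ℝ}

theorem IsTimeDerivative.intervalIntegrable (h : IsTimeDerivative T u v) {s t : ℝ}
    (hs : s ∈ Icc 0 T) (ht : t ∈ Icc 0 T) (x : RSpace d) :
    IntervalIntegrable (fun r => v r x) volume s t := by
  refine (h x).1.mono_set ?_
  rw [uIcc_of_le (hs.1.trans hs.2)]
  exact uIcc_subset_Icc hs ht

theorem IsTimeDerivative.sub_eq (h : IsTimeDerivative T u v) {s t : ℝ}
    (hs : s ∈ Icc 0 T) (ht : t ∈ Icc 0 T) (x : RSpace d) :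
    u t x - u s x = ∫ r in s..t, v r x := by
  have h0 : (0 : ℝ) ∈ Icc 0 T := ⟨le_rfl, hs.1.trans hs.2⟩
  rw [(h x).2 t ht, (h x).2 s hs, add_sub_add_left_eq_sub,
    intervalIntegral.integral_interval_sub_left (h.intervalIntegrable h0 ht x)
      (h.intervalIntegrable h0 hs x)]

theorem IsTimeDerivative.abs_sub_le (h : IsTimeDerivative T u v) {V : ℝ}
    (hV : ∀ᵐ t ∂(volume.restrict (Icc 0 T)), ∀ x, |v t x| ≤ V) {s t : ℝ}
    (hs : s ∈ Icc 0 T) (ht : t ∈ Icc 0 T) (x : RSpace d) :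
    |u t x - u s x| ≤ V * |t - s| := by
  rw [h.sub_eq hs ht x]
  rw [← Real.norm_eq_abs]
  refine intervalIntegral.norm_integral_le_of_norm_le_const_ae ?_
  filter_upwards [(ae_restrict_iff' measurableSet_Icc).1 hV] with r hr hrm
  exact hr (uIcc_subset_Icc hs ht (uIoc_subset_uIcc hrm)) x

theorem IsTimeDerivative.continuousOn (h : IsTimeDerivative T u v) {V : ℝ}
    (hV : ∀ᵐ t ∂(volume.restrict (Icc 0 T)), ∀ x, |v t x| ≤ V)
    (hcont : ∀ t ∈ Icc 0 T, Continuous (u t)) :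
    ContinuousOn (fun p : ℝ × RSpace d => u p.1 p.2) (Icc 0 T ×ˢ univ) := by
  refine continuousOn_prod_of_continuousOn_lipschitzOnWith _ V.toNNReal
    (fun t ht => (hcont t ht).continuousOn) fun x _ => ?_
  refine LipschitzOnWith.of_dist_le_mul fun s hs t ht => ?_
  rw [Real.dist_eq, Real.dist_eq]
  refine (h.abs_sub_le hV ht hs x).trans ?_
  gcongr
  exact Real.le_coe_toNNReal V

end

section

variable {d : ℕ} {T : ℝ} {u v : ℝ → RSpace d → ℝ}

/-- Where the spatial second differences of the third difference of `u(t)` are bounded above,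
the third difference of `u` cannot have increased fast just before time `t`. -/
theorem exists_cubeDiff_sub_le {β α c₀ D F N V : ℝ} (hβ : β ∈ Ioo (0 : ℝ) 1) (hc₀ : 0 < c₀)
    (hα : 0 < α) {a : ℝ → RSpace d → Matrix (Fin d) (Fin d) ℝ} (ha : IsHolderElliptic c₀ β a)
    {f : ℝ → RSpace d → ℝ} (hder : IsTimeDerivative T u v)
    (hV0 : 0 ≤ V) (hV : ∀ᵐ t ∂(volume.restrict (Icc 0 T)), ∀ x, |v t x| ≤ V)
    (hF : 0 ≤ F)
    (hreg : ∀ᵐ t ∂(volume.restrict (Icc 0 T)), RegularSlice β α D F N (a t) (u t) (v t) (f t))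
    {e : RSpace d} (he : ‖e‖ = 1) {t : ℝ} (ht : t ∈ Ioc 0 T) (x : RSpace d) {h : Fin 3 → ℝ} {M : ℝ}
    (hM0 : 0 ≤ M) (hM : ∀ i, |h i| ≤ M) {η κ k₀ : ℝ} (hη : 0 < η) (hk₀ : 0 < k₀)
    (hx : ∀ b, ∑ ε, cubeSign ε * symmDiff2 b (u t) (x + cubeShift ε h • e) ≤ 2 * η * ‖b‖ ^ 2)
    (hh : ∀ k, 0 < k → k ≤ k₀ →
      ∑ ε, cubeSign ε * symmDiff2 (k • e) (u t) (x + cubeShift ε h • e) ≤ (2 * η - κ) * k ^ 2) :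
    ∃ s ∈ Ico 0 t, cubeDiff e (u t) x h - cubeDiff e (u s) x h ≤
      (c₀⁻¹ * (3 * η - κ) + c₀ * d * (3 * η) + 24 * (c₀ * d ^ 2 * D + F) * M ^ β) * (t - s) := by
  set y : (Fin 3 → Bool) → RSpace d := fun ε => x + cubeShift ε h • e
  set Q : ℝ := c₀⁻¹ * (3 * η - κ) + c₀ * d * (3 * η) + 24 * (c₀ * d ^ 2 * D + F) * M ^ β
  have htI : t ∈ Icc 0 T := ⟨ht.1.le, ht.2⟩
  obtain ⟨k, hk0, hkk, hkη⟩ : ∃ k, 0 < k ∧ k ≤ k₀ ∧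
      8 * (N * k ^ α / (1 - (2 : ℝ) ^ (-α))) ≤ η / 2 := by
    have hc : Filter.Tendsto (fun k : ℝ => 8 * (N * k ^ α / (1 - (2 : ℝ) ^ (-α))))
        (nhdsWithin 0 (Ioi 0)) (nhds (8 * (N * 0 ^ α / (1 - (2 : ℝ) ^ (-α))))) := by
      refine tendsto_nhdsWithin_of_tendsto_nhds (Continuous.tendsto ?_ 0)
      exact continuous_const.mul ((continuous_const.mul
        (Real.continuous_rpow_const hα.le)).div_const _)
    rw [Real.zero_rpow hα.ne', mul_zero, zero_div, mul_zero] at hc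
    have h1 := hc.eventually (eventually_le_nhds (half_pos hη))
    have h2 : ∀ᶠ k : ℝ in nhdsWithin 0 (Ioi 0), k ∈ Ioc 0 k₀ := Ioc_mem_nhdsGT hk₀
    obtain ⟨k, a1, a2⟩ := (h1.and h2).exists
    exact ⟨k, a2.1, a2.2, a1⟩
  set δ : ℝ := η * k ^ 2 / (64 * V + 1)
  have hδ : 0 < δ := by positivity
  have hVδ : 32 * (V * δ) ≤ η / 2 * k ^ 2 := by
    have : V * δ * 64 ≤ η * k ^ 2 := by
      simp only [δ]
      rw [mul_div_assoc', div_mul_eq_mul_div, div_le_iff₀ (by positivity)]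
      have : 0 ≤ η * k ^ 2 := by positivity
      nlinarith
    linarith
  set s : ℝ := max 0 (t - δ)
  have hs0 : 0 ≤ s := le_max_left _ _
  have hst : s < t := max_lt ht.1 (by linarith)
  have hsδ : t - s ≤ δ := by linarith [le_max_right 0 (t - δ)]
  have hsI : s ∈ Icc 0 T := ⟨hs0, hst.le.trans ht.2⟩
  refine ⟨s, ⟨hs0, hst⟩, ?_⟩
  have hrate (r : ℝ) (hr : r ∈ Icc s t)
      (hrs : RegularSlice β α D F N (a r) (u r) (v r) (f r)) :
      ∑ ε, cubeSign ε * v r (y ε) ≤ Q := by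
    have hrI : r ∈ Icc 0 T := ⟨hs0.trans hr.1, hr.2.trans ht.2⟩
    have htr : V * |r - t| ≤ V * δ := by
      gcongr; rw [abs_sub_comm, abs_of_nonneg (by linarith [hr.2])]; linarith [hr.1]
    have hdiff (b : RSpace d) : ∑ ε, cubeSign ε * symmDiff2 b (u r) (y ε) ≤
        ∑ ε, cubeSign ε * symmDiff2 b (u t) (y ε) + 32 * (V * δ) := by
      have h1 (ε) : |symmDiff2 b (u r) (y ε) - symmDiff2 b (u t) (y ε)| ≤ 4 * (V * δ) := by
        have a1 := abs_le.1 ((hder.abs_sub_le hV htI hrI (y ε + b)).trans htr)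
        have a2 := abs_le.1 ((hder.abs_sub_le hV htI hrI (y ε - b)).trans htr)
        have a3 := abs_le.1 ((hder.abs_sub_le hV htI hrI (y ε)).trans htr)
        rw [abs_le, symmDiff2, symmDiff2]
        constructor <;> linarith [a1.1, a1.2, a2.1, a2.2, a3.1, a3.2]
      have h2 := (le_abs_self _).trans (abs_sum_cubeSign_mul_le h1)
      simp only [mul_sub, Finset.sum_sub_distrib] at h2
      linarith
    have hscale (b : RSpace d) (hb : ‖b‖ = 1) : k ^ 2 * ∑ ε, cubeSign ε * hess (u r) (y ε) b b ≤
        ∑ ε, cubeSign ε * symmDiff2 (k • b) (u t) (y ε) + η * k ^ 2 := by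
      have h1 (ε) : |hess (u r) (y ε) (k • b) (k • b) - symmDiff2 (k • b) (u r) (y ε)| ≤
          N * k ^ α / (1 - (2 : ℝ) ^ (-α)) * k ^ 2 := by
        have := abs_symmDiff2_sub_hess_le hrs.contDiff hα hrs.third (y ε) (k • b)
        rw [abs_sub_comm, norm_smul, hb, mul_one, Real.norm_of_nonneg hk0.le, Real.rpow_add hk0,
          Real.rpow_two] at this
        exact this.trans (le_of_eq (by ring))
      have h2 := (le_abs_self _).trans (abs_sum_cubeSign_mul_le h1)
      simp only [mul_sub, Finset.sum_sub_distrib] at h2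
      have h3 : ∑ ε, cubeSign ε * hess (u r) (y ε) (k • b) (k • b) =
          k ^ 2 * ∑ ε, cubeSign ε * hess (u r) (y ε) b b := by
        rw [Finset.mul_sum]
        refine Finset.sum_congr rfl fun ε _ => ?_
        simp only [map_smul, smul_apply, smul_eq_mul]
        ring
      rw [h3] at h2
      have h4 := hdiff (k • b)
      have h5 : 8 * (N * k ^ α / (1 - (2 : ℝ) ^ (-α))) * k ^ 2 ≤ η / 2 * k ^ 2 := by gcongr
      linarith
    have hk2 : 0 < k ^ 2 := by positivity
    have hunit (b : RSpace d) (hb : ‖b‖ = 1) :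
        ∑ ε, cubeSign ε * hess (u r) (y ε) b b ≤ 3 * η := by
      have h1 := hscale b hb
      have h2 := hx (k • b)
      rw [norm_smul, hb, mul_one, Real.norm_of_nonneg hk0.le] at h2
      refine le_of_mul_le_mul_left (h1.trans ?_) hk2
      linarith
    refine hrs.sum_le hβ hc₀ ha hrI.1 hF he x hM0 hM (by positivity) (fun b => ?_) ?_
    · rcases eq_or_ne b 0 with rfl | hb
      · simp
      · have hb' : 0 < ‖b‖ := norm_pos_iff.2 hb
        have h1 := hunit (‖b‖⁻¹ • b) (by rw [norm_smul, norm_inv, norm_norm,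
          inv_mul_cancel₀ hb'.ne'])
        have h2 : ∑ ε, cubeSign ε * hess (u r) (y ε) b b = ‖b‖ ^ 2 *
            ∑ ε, cubeSign ε * hess (u r) (y ε) (‖b‖⁻¹ • b) (‖b‖⁻¹ • b) := by
          rw [Finset.mul_sum]
          refine Finset.sum_congr rfl fun ε _ => ?_
          simp only [map_smul, smul_apply, smul_eq_mul]
          field_simp
        rw [h2, mul_comm]
        gcongr
    · have h1 := hscale e he
      have h2 := hh k hk0 hkk
      refine le_of_mul_le_mul_left (h1.trans ?_) hk2
      linarith
  have hint (ε) : IntervalIntegrable (fun r => cubeSign ε * v r (y ε)) volume s t :=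
    (hder.intervalIntegrable hsI htI _).const_mul _
  have hsum : cubeDiff e (u t) x h - cubeDiff e (u s) x h =
      ∫ r in s..t, ∑ ε, cubeSign ε * v r (y ε) := by
    rw [intervalIntegral.integral_finsetSum fun ε _ => hint ε, cubeDiff, cubeDiff,
      ← Finset.sum_sub_distrib]
    refine Finset.sum_congr rfl fun ε _ => ?_
    rw [intervalIntegral.integral_const_mul, ← hder.sub_eq hsI htI]
    ring
  have hQ : Q * (t - s) = ∫ _r in s..t, Q := by simp [mul_comm]
  have hInt : IntervalIntegrable (fun r => ∑ ε, cubeSign ε * v r (y ε)) volume s t := by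
    have h1 := IntervalIntegrable.sum Finset.univ fun ε _ => hint ε
    have h2 : (∑ ε, fun r => cubeSign ε * v r (y ε)) = fun r => ∑ ε, cubeSign ε * v r (y ε) := by
      funext r
      simp
    rwa [h2] at h1
  rw [hsum, hQ]
  refine intervalIntegral.integral_mono_ae_restrict hst.le hInt (by simp) ?_
  have hreg' := ae_restrict_of_ae_restrict_of_subset
    (Icc_subset_Icc hs0 ht.2 : Icc s t ⊆ Icc 0 T) hreg
  filter_upwards [hreg', ae_restrict_mem measurableSet_Icc] with r hr hrm
  exact hrate r hrm hr

end

theorem sum_sq_update (h : Fin 3 → ℝ) (i : Fin 3) (s : ℝ) :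
    ∑ j, Function.update h i s j ^ 2 = ∑ j, h j ^ 2 - h i ^ 2 + s ^ 2 := by
  rw [← Finset.add_sum_erase _ _ (Finset.mem_univ i),
    ← Finset.add_sum_erase Finset.univ (fun j => h j ^ 2) (Finset.mem_univ i), Function.update_self,
    Finset.sum_congr rfl fun j hj => by rw [Function.update_of_ne (Finset.ne_of_mem_erase hj)]]
  ring

section

variable {d : ℕ} {T : ℝ} {u v : ℝ → RSpace d → ℝ}

/-- The third difference minus the barrier and the penalisation. -/
def penalised (A B γ η : ℝ) (e : RSpace d) (u : ℝ → RSpace d → ℝ)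
    (p : ℝ × RSpace d × (Fin 3 → ℝ)) : ℝ :=
  cubeDiff e (u p.1) p.2.1 p.2.2 - A * barrier γ p.2.2 -
    η * (‖p.2.1‖ ^ 2 + ∑ i, p.2.2 i ^ 2) - B * η * p.1

/-- A positive value of the penalised difference is dominated by a global maximum. -/
theorem exists_isMaxOn_penalised {A B γ η U : ℝ} (hA : 0 ≤ A) (hB : 0 ≤ B) (hγ : 0 ≤ γ)
    (hη : 0 < η) (e : RSpace d)
    (hcont : ContinuousOn (fun p : ℝ × RSpace d => u p.1 p.2) (Icc 0 T ×ˢ univ))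
    (hU : ∀ t ∈ Icc 0 T, ∀ x, |u t x| ≤ U)
    {p₀ : ℝ × RSpace d × (Fin 3 → ℝ)} (hp₀ : p₀.1 ∈ Icc 0 T ∧ ∀ i, 0 ≤ p₀.2.2 i)
    (hpos : 0 < penalised A B γ η e u p₀) :
    ∃ p : ℝ × RSpace d × (Fin 3 → ℝ), (p.1 ∈ Icc 0 T ∧ ∀ i, 0 ≤ p.2.2 i) ∧
      0 < penalised A B γ η e u p ∧
      ∀ q : ℝ × RSpace d × (Fin 3 → ℝ), q.1 ∈ Icc 0 T → (∀ i, 0 ≤ q.2.2 i) →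
        penalised A B γ η e u q ≤ penalised A B γ η e u p := by
  have hU0 : 0 ≤ U := (abs_nonneg _).trans (hU p₀.1 hp₀.1 0)
  set R : ℝ := 8 * U / η + 1
  have hR1 : 1 ≤ R := by simp only [R]; linarith [show 0 ≤ 8 * U / η by positivity]
  have hR2 : 8 * U < η * R ^ 2 := by
    have : 8 * U < η * R := by simp only [R]; rw [mul_add, mul_div_cancel₀ _ hη.ne']; linarith
    nlinarith
  set K : Set (ℝ × RSpace d × (Fin 3 → ℝ)) :=
    Icc 0 T ×ˢ (Metric.closedBall 0 R ×ˢ Icc 0 fun _ => R)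
  have hKc : IsCompact K := isCompact_Icc.prod ((isCompact_closedBall _ _).prod isCompact_Icc)
  have hin (q : ℝ × RSpace d × (Fin 3 → ℝ)) (hq : q.1 ∈ Icc 0 T) (hq2 : ∀ i, 0 ≤ q.2.2 i)
      (hqp : 0 < penalised A B γ η e u q) : q ∈ K := by
    have h1 : cubeDiff e (u q.1) q.2.1 q.2.2 ≤ 8 * U :=
      (le_abs_self _).trans (abs_sum_cubeSign_mul_le fun ε => hU _ hq _)
    have h2 := mul_nonneg hA (barrier_nonneg (γ := γ) hq2)
    have h3 : 0 ≤ B * η * q.1 := mul_nonneg (mul_nonneg hB hη.le) hq.1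
    have h4 : η * (‖q.2.1‖ ^ 2 + ∑ i, q.2.2 i ^ 2) < η * R ^ 2 := by
      simp only [penalised] at hqp; linarith
    have h5 : ‖q.2.1‖ ^ 2 + ∑ i, q.2.2 i ^ 2 < R ^ 2 := lt_of_mul_lt_mul_left h4 hη.le
    have h6 : 0 ≤ ∑ i, q.2.2 i ^ 2 := Finset.sum_nonneg fun _ _ => sq_nonneg _
    refine ⟨hq, ?_, hq2, fun i => ?_⟩
    · rw [mem_closedBall_zero_iff]
      exact (abs_le_of_sq_le_sq' (by linarith) (by linarith)).2
    · have h7 := Finset.single_le_sum (f := fun i => q.2.2 i ^ 2) (fun _ _ => sq_nonneg _)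
        (Finset.mem_univ i)
      have h8 := sq_nonneg ‖q.2.1‖
      exact (abs_le_of_sq_le_sq' (by linarith) (by linarith)).2
  have hcW : ContinuousOn (penalised A B γ η e u) K := by
    have hc1 : ContinuousOn (fun p : ℝ × RSpace d × (Fin 3 → ℝ) =>
        cubeDiff e (u p.1) p.2.1 p.2.2) K := by
      refine continuousOn_finsetSum _ fun ε _ => continuousOn_const.mul ?_
      refine hcont.comp (f := fun p : ℝ × RSpace d × (Fin 3 → ℝ) =>
        (p.1, p.2.1 + cubeShift ε p.2.2 • e)) ?_ fun p hp => ⟨hp.1, trivial⟩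
      unfold cubeShift
      fun_prop
    have hc2 : Continuous (fun p : ℝ × RSpace d × (Fin 3 → ℝ) => barrier γ p.2.2) := by
      refine continuous_finsetProd _ fun i _ => ?_
      exact (Real.continuous_rpow_const hγ).comp (by fun_prop)
    unfold penalised
    refine ((hc1.sub (hc2.const_mul A).continuousOn).sub ?_).sub ?_ <;> fun_prop
  obtain ⟨p, hpK, hmax⟩ := hKc.exists_isMaxOn ⟨p₀, hin p₀ hp₀.1 hp₀.2 hpos⟩ hcW
  have hp0 : 0 < penalised A B γ η e u p := hpos.trans_le (hmax (hin p₀ hp₀.1 hp₀.2 hpos))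
  refine ⟨p, ⟨hpK.1, hpK.2.2.1⟩, hp0, fun q hq hq2 => ?_⟩
  rcases le_or_gt (penalised A B γ η e u q) 0 with h | h
  · exact h.trans hp0.le
  · exact hmax (hin q hq hq2 h)

/-- **Maximum principle for third differences** of a solution of a parabolic equation. -/
theorem cubeDiff_le_barrier {β α γ c₀ D F N U V : ℝ} (hβ : β ∈ Ioo (0 : ℝ) 1) (hc₀ : 0 < c₀)
    (hα : 0 < α) (hγ : 3 * γ = 2 + β) {a : ℝ → RSpace d → Matrix (Fin d) (Fin d) ℝ}
    (ha : IsHolderElliptic c₀ β a) {f : ℝ → RSpace d → ℝ} (hder : IsTimeDerivative T u v)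
    (hu0 : ∀ x, u 0 x = 0) (hcont : ∀ t ∈ Icc 0 T, Continuous (u t))
    (hU : ∀ t ∈ Icc 0 T, ∀ x, |u t x| ≤ U)
    (hV0 : 0 ≤ V) (hV : ∀ᵐ t ∂(volume.restrict (Icc 0 T)), ∀ x, |v t x| ≤ V)
    (hD : 0 ≤ D) (hF : 0 ≤ F)
    (hreg : ∀ᵐ t ∂(volume.restrict (Icc 0 T)), RegularSlice β α D F N (a t) (u t) (v t) (f t))
    {e : RSpace d} (he : ‖e‖ = 1) {t : ℝ} (ht : t ∈ Icc 0 T) (x : RSpace d) {h : Fin 3 → ℝ}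
    (hh : ∀ i, 0 ≤ h i) :
    cubeDiff e (u t) x h ≤
      48 * c₀ * (c₀ * d ^ 2 * D + F) / (γ * (1 - γ)) * barrier γ h := by
  have hγ0 : 0 < γ := by linarith [hβ.1]
  have hγ1 : γ < 1 := by linarith [hβ.2]
  have hγγ : 0 < γ * (1 - γ) := mul_pos hγ0 (by linarith)
  set A : ℝ := 48 * c₀ * (c₀ * d ^ 2 * D + F) / (γ * (1 - γ))
  have hA : 0 ≤ A := by positivity
  set B : ℝ := 3 * (c₀⁻¹ + c₀ * d) + 1
  have hB : 0 ≤ B := by positivity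
  have hη : ∀ η : ℝ, 0 < η → penalised A B γ η e u (t, x, h) ≤ 0 := by
    intro η hη
    by_contra! hpos
    obtain ⟨⟨t, x, h⟩, ⟨ht, hh⟩, hp, hmax⟩ := exists_isMaxOn_penalised hA hB hγ0.le hη e
      (hder.continuousOn hV hcont) hU (p₀ := (t, x, h)) ⟨ht, hh⟩ hpos
    dsimp only at ht hh
    have hnp : cubeDiff e (u t) x h ≠ 0 := fun h0 => by
      have h2 := mul_nonneg hA (barrier_nonneg (γ := γ) hh)
      have h3 : 0 ≤ B * η * t := mul_nonneg (mul_nonneg hB hη.le) ht.1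
      have h4 : 0 ≤ η * (‖x‖ ^ 2 + ∑ i, h i ^ 2) := by positivity
      simp only [penalised, h0] at hp
      linarith
    have hpos' (i) : 0 < h i := (hh i).lt_of_ne fun h0 => hnp (cubeDiff_eq_zero e _ x h0.symm)
    have ht0 : 0 < t := ht.1.lt_of_ne fun h0 => hnp (by simp [cubeDiff, ← h0, hu0])
    obtain ⟨i, hi⟩ := Finite.exists_min h
    obtain ⟨m, hm⟩ := Finite.exists_max h
    have hx (b : RSpace d) :
        ∑ ε, cubeSign ε * symmDiff2 b (u t) (x + cubeShift ε h • e) ≤ 2 * η * ‖b‖ ^ 2 := by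
      rw [← symmDiff2_cubeDiff, symmDiff2]
      have h1 := hmax (t, x + b, h) ht hh
      have h2 := hmax (t, x - b, h) ht hh
      have h3 := parallelogram_law_with_norm ℝ x b
      simp only [penalised] at h1 h2
      nlinarith
    have hk (k : ℝ) (hk0 : 0 < k) (hki : k ≤ h i) :
        ∑ ε, cubeSign ε * symmDiff2 (k • e) (u t) (x + cubeShift ε h • e) ≤
          (2 * η - A * (γ * (1 - γ) / 2) * h m ^ β) * k ^ 2 := by
      rw [← cubeDiff_update e (u t) x h i k]
      have hup (s : ℝ) (hs : 0 ≤ s) (j) : 0 ≤ Function.update h i s j := by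
        by_cases hj : j = i
        · subst hj; simpa using hs
        · rw [Function.update_of_ne hj]; exact hh j
      have h1 := hmax (t, x, Function.update h i (h i + k)) ht (hup _ (by linarith [hh i]))
      have h2 := hmax (t, x, Function.update h i (h i - k)) ht (hup _ (by linarith))
      have h3 := mul_le_mul_of_nonneg_left
        (barrier_symmDiff_le hγ hγ0.le hγ1.le hpos' hi m hk0.le hki) hA
      simp only [penalised, sum_sq_update] at h1 h2
      linarith
    obtain ⟨s, hs, hle⟩ := exists_cubeDiff_sub_le hβ hc₀ hα ha hder hV0 hV hF hreg he
      ⟨ht0, ht.2⟩ x (hh m) (fun j => by rw [abs_of_nonneg (hh j)]; exact hm j) hη (hpos' i) hx hk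
    have h1 := hmax (s, x, h) ⟨hs.1, hs.2.le.trans ht.2⟩ hh
    simp only [penalised] at h1
    have hAK : c₀⁻¹ * (A * (γ * (1 - γ) / 2) * h m ^ β) =
        24 * (c₀ * d ^ 2 * D + F) * h m ^ β := by
      have hA' : A * (γ * (1 - γ)) = 48 * c₀ * (c₀ * d ^ 2 * D + F) := div_mul_cancel₀ _ hγγ.ne'
      have : A * (γ * (1 - γ) / 2) = c₀ * (24 * (c₀ * d ^ 2 * D + F)) := by linarith
      rw [this, ← mul_assoc, inv_mul_cancel_left₀ hc₀.ne']
    have h2 : c₀⁻¹ * (3 * η - A * (γ * (1 - γ) / 2) * h m ^ β) + c₀ * d * (3 * η) +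
        24 * (c₀ * d ^ 2 * D + F) * h m ^ β = (B - 1) * η := by
      rw [mul_sub, hAK]; simp only [B]; ring
    rw [h2] at hle
    have h3 : 0 < η * (t - s) := mul_pos hη (by linarith [hs.2])
    linarith
  have hlim : Filter.Tendsto (fun η : ℝ => penalised A B γ η e u (t, x, h))
      (nhdsWithin 0 (Ioi 0)) (nhds (penalised A B γ 0 e u (t, x, h))) := by
    refine tendsto_nhdsWithin_of_tendsto_nhds (Continuous.tendsto ?_ 0)
    unfold penalised
    fun_prop
  have h0 := le_of_tendsto hlim (by filter_upwards [self_mem_nhdsWithin] with η hη' using hη η hη')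
  simp only [penalised, zero_mul, mul_zero, sub_zero] at h0
  linarith

end

theorem abs_apply_single_le_of_diag {d : ℕ} {B : RSpace d →L[ℝ] RSpace d →L[ℝ] ℝ}
    (hB : ∀ b b', B b b' = B b' b) {lam : ℝ} (hlam : ∀ b, ‖b‖ = 1 → |B b b| ≤ lam) (i j : Fin d) :
    |B (EuclideanSpace.single i 1) (EuclideanSpace.single j 1)| ≤ lam := by
  have hdiag (b : RSpace d) : |B b b| ≤ lam * ‖b‖ ^ 2 := by
    rcases eq_or_ne b 0 with rfl | hb
    · simp
    · have hb' : 0 < ‖b‖ := norm_pos_iff.2 hb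
      have h1 := hlam (‖b‖⁻¹ • b) (by rw [norm_smul, norm_inv, norm_norm, inv_mul_cancel₀ hb'.ne'])
      have h2 : B b b = ‖b‖ ^ 2 * B (‖b‖⁻¹ • b) (‖b‖⁻¹ • b) := by
        simp only [map_smul, smul_apply, smul_eq_mul]
        field_simp
      rw [h2, abs_mul, abs_of_nonneg (by positivity), mul_comm]
      gcongr
  set p : RSpace d := EuclideanSpace.single i 1
  set q : RSpace d := EuclideanSpace.single j 1
  have h1 := hdiag (p + q)
  have h2 := hdiag (p - q)
  have h3 := parallelogram_law_with_norm ℝ p q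
  have hp : ‖p‖ = 1 := by simp [p]
  have hq : ‖q‖ = 1 := by simp [q]
  have h4 : B p q * 4 = B (p + q) (p + q) - B (p - q) (p - q) := by
    simp only [map_add, map_sub, add_apply, sub_apply, hB q p]
    ring
  have h5 : |B p q| * 4 ≤ lam * ‖p + q‖ ^ 2 + lam * ‖p - q‖ ^ 2 := by
    rw [← abs_of_pos (four_pos : (0 : ℝ) < 4), ← abs_mul, h4]
    exact (abs_sub _ _).trans (add_le_add h1 h2)
  rw [hp, hq] at h3
  have h6 : lam * ‖p + q‖ ^ 2 + lam * ‖p - q‖ ^ 2 = lam * 4 := by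
    rw [← mul_add]; congr 1; nlinarith
  linarith

theorem secondPartial_eq_hess {d : ℕ} {g : RSpace d → ℝ} (hg : ContDiff ℝ 2 g) (i j : Fin d)
    (x : RSpace d) :
    secondPartial i j g x = hess g x (EuclideanSpace.single i 1) (EuclideanSpace.single j 1) := by
  have hd1 : Differentiable ℝ g := hg.differentiable (by norm_num)
  have h1 : (fun y => lineDeriv ℝ g y (EuclideanSpace.single j 1)) =
      fun y => fderiv ℝ g y (EuclideanSpace.single j 1) :=
    funext fun y => (hd1 y).lineDeriv_eq_fderiv
  have h0 := hasFDerivAt_fderiv_apply hg x (EuclideanSpace.single j 1)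
  rw [secondPartial, h1, h0.differentiableAt.lineDeriv_eq_fderiv, h0.fderiv]
  rfl

theorem hess_symm {d : ℕ} {g : RSpace d → ℝ} (hg : ContDiff ℝ 2 g) (x b b' : RSpace d) :
    hess g x b b' = hess g x b' b :=
  (hg.contDiffAt.isSymmSndFDerivAt (by simp)).eq b b'

/-- Interpolation: third differences control the second derivatives. -/
theorem RegularSlice.improve {d : ℕ} {β α D F N N' U ρ : ℝ}
    {A : RSpace d → Matrix (Fin d) (Fin d) ℝ} {g w f : RSpace d → ℝ} (hβ : 0 < β)
    (hs : RegularSlice β α D F N A g w f)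
    (hN' : ∀ x h, |(fwdDiff h)^[3] g x| ≤ N' * ‖h‖ ^ (2 + β)) (hU : ∀ x, |g x| ≤ U)
    (hρ : 0 < ρ) {D' : ℝ} (hD' : N' * ρ ^ β / (1 - (2 : ℝ) ^ (-β)) + 4 * U / ρ ^ 2 ≤ D') :
    RegularSlice β α D' F N A g w f :=
  { hs with
    hess_le := fun x => abs_apply_single_le_of_diag (hess_symm hs.contDiff x) fun _ hb =>
      (abs_hess_le_of_thirdDiff hs.contDiff hβ hN' hU hρ x hb).trans hD' }

section

variable {d : ℕ} {T : ℝ} {u v : ℝ → RSpace d → ℝ}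

theorem abs_fwdDiff_three_le {β α c₀ D F N U V : ℝ} (hβ : β ∈ Ioo (0 : ℝ) 1) (hc₀ : 0 < c₀)
    (hα : 0 < α) {a : ℝ → RSpace d → Matrix (Fin d) (Fin d) ℝ}
    (ha : IsHolderElliptic c₀ β a) {f : ℝ → RSpace d → ℝ} (hder : IsTimeDerivative T u v)
    (hu0 : ∀ x, u 0 x = 0) (hcont : ∀ t ∈ Icc 0 T, Continuous (u t))
    (hU : ∀ t ∈ Icc 0 T, ∀ x, |u t x| ≤ U)
    (hV0 : 0 ≤ V) (hV : ∀ᵐ t ∂(volume.restrict (Icc 0 T)), ∀ x, |v t x| ≤ V)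
    (hD : 0 ≤ D) (hF : 0 ≤ F)
    (hreg : ∀ᵐ t ∂(volume.restrict (Icc 0 T)), RegularSlice β α D F N (a t) (u t) (v t) (f t))
    {t : ℝ} (ht : t ∈ Icc 0 T) (x h : RSpace d) :
    |(fwdDiff h)^[3] (u t) x| ≤
      48 * c₀ / ((2 + β) / 3 * (1 - (2 + β) / 3)) * (c₀ * d ^ 2 * D + F) * ‖h‖ ^ (2 + β) := by
  rcases eq_or_ne h 0 with rfl | hh
  · rw [fwdDiff_iter_three (F := ℝ), norm_zero, Real.zero_rpow (by linarith [hβ.1])]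
    simp
  set γ : ℝ := (2 + β) / 3
  have hγ : 3 * γ = 2 + β := by simp only [γ]; ring
  have hγ0 : 0 < γ := by linarith [hβ.1]
  have hγ1 : 0 < 1 - γ := by linarith [hβ.2]
  have hh' : 0 < ‖h‖ := norm_pos_iff.2 hh
  set e : RSpace d := ‖h‖⁻¹ • h
  have he : ‖e‖ = 1 := by rw [norm_smul, norm_inv, norm_norm, inv_mul_cancel₀ hh'.ne']
  have hhe : h = ‖h‖ • e := by rw [smul_smul, mul_inv_cancel₀ hh'.ne', one_smul]
  have hbar : barrier γ (fun _ => ‖h‖ / 2) ≤ ‖h‖ ^ (2 + β) := by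
    have : barrier γ (fun _ => ‖h‖ / 2) = (‖h‖ / 2) ^ (2 + β) := by
      rw [barrier, Finset.prod_const, Finset.card_univ, Fintype.card_fin, ← Real.rpow_natCast,
        ← Real.rpow_mul (by positivity), ← hγ]
      congr 1; push_cast; ring
    rw [this]
    exact Real.rpow_le_rpow (by positivity) (by linarith) (by linarith [hβ.1])
  set A : ℝ := 48 * c₀ * (c₀ * d ^ 2 * D + F) / (γ * (1 - γ))
  have hA : 0 ≤ A := by positivity
  have hAeq : 48 * c₀ / (γ * (1 - γ)) * (c₀ * d ^ 2 * D + F) = A := by simp only [A]; ring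
  have key (e : RSpace d) (he : ‖e‖ = 1) (y : RSpace d) :
      cubeDiff e (u t) y (fun _ => ‖h‖ / 2) ≤ A * ‖h‖ ^ (2 + β) :=
    (cubeDiff_le_barrier hβ hc₀ hα hγ ha hder hu0 hcont hU hV0 hV hD hF hreg he ht y
      fun _ => by positivity).trans (mul_le_mul_of_nonneg_left hbar hA)
  rw [hAeq]
  nth_rewrite 1 [hhe]
  rw [fwdDiff_iter_three_eq_cubeDiff, abs_le]
  refine ⟨?_, key e he _⟩
  have := key (-e) (by rw [norm_neg, he]) (x + (3 * ‖h‖ / 2) • e)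
  rw [cubeDiff_neg] at this
  linarith

/-- The a priori estimate: absorption of the second derivatives by interpolation. -/
theorem abs_fwdDiff_three_le_of_regularSlice {β α c₀ D F N U V ρ : ℝ} (hβ : β ∈ Ioo (0 : ℝ) 1)
    (hc₀ : 0 < c₀) (hα : 0 < α) {a : ℝ → RSpace d → Matrix (Fin d) (Fin d) ℝ}
    (ha : IsHolderElliptic c₀ β a) {f : ℝ → RSpace d → ℝ} (hder : IsTimeDerivative T u v)
    (hu0 : ∀ x, u 0 x = 0) (hcont : ∀ t ∈ Icc 0 T, Continuous (u t))
    (hU0 : 0 ≤ U) (hU : ∀ t ∈ Icc 0 T, ∀ x, |u t x| ≤ U)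
    (hV0 : 0 ≤ V) (hV : ∀ᵐ t ∂(volume.restrict (Icc 0 T)), ∀ x, |v t x| ≤ V)
    (hD : 0 ≤ D) (hF : 0 ≤ F)
    (hreg : ∀ᵐ t ∂(volume.restrict (Icc 0 T)), RegularSlice β α D F N (a t) (u t) (v t) (f t))
    (hρ : 0 < ρ)
    (hρβ : 48 * c₀ / ((2 + β) / 3 * (1 - (2 + β) / 3)) * (c₀ * d ^ 2 + 1) * ρ ^ β /
      (1 - (2 : ℝ) ^ (-β)) ≤ 1 / 2)
    {t : ℝ} (ht : t ∈ Icc 0 T) (x h : RSpace d) :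
    |(fwdDiff h)^[3] (u t) x| ≤
      48 * c₀ / ((2 + β) / 3 * (1 - (2 + β) / 3)) *
        (c₀ * d ^ 2 * (F + 8 * U / ρ ^ 2) + F) * ‖h‖ ^ (2 + β) := by
  set κ : ℝ := 48 * c₀ / ((2 + β) / 3 * (1 - (2 + β) / 3))
  have hκ : 0 ≤ κ := by
    have h1 := hβ.1
    have : 0 < 1 - (2 + β) / 3 := by linarith [hβ.2]
    positivity
  have h2β : 0 < 1 - (2 : ℝ) ^ (-β) := by
    linarith [Real.rpow_lt_one_of_one_lt_of_neg one_lt_two (by linarith [hβ.1] : -β < 0)]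
  set E : ℝ := F + 8 * U / ρ ^ 2
  have hE : 0 ≤ E := by positivity
  have hn (n : ℕ) : ∀ᵐ t ∂(volume.restrict (Icc 0 T)),
      RegularSlice β α (E + D / 2 ^ n) F N (a t) (u t) (v t) (f t) := by
    induction n with
    | zero =>
      filter_upwards [hreg] with t ht
      exact { ht with hess_le := fun x i j => (ht.hess_le x i j).trans (by simpa using hE) }
    | succ n ih =>
      set Dn := E + D / 2 ^ n
      have hDn : 0 ≤ Dn := by positivity
      filter_upwards [ih, ae_restrict_mem measurableSet_Icc] with t ht htI
      refine ht.improve hβ.1 (fun x h => abs_fwdDiff_three_le hβ hc₀ hα ha hder hu0 hcont hU hV0 hV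
        hDn hF ih htI x h) (hU t htI) hρ ?_
      have h1 : κ * (c₀ * d ^ 2 * Dn + F) ≤ κ * (c₀ * d ^ 2 + 1) * (Dn + F) := by
        rw [mul_assoc κ]
        refine mul_le_mul_of_nonneg_left ?_ hκ
        have : 0 ≤ c₀ * (d : ℝ) ^ 2 * F := by positivity
        linarith
      calc κ * (c₀ * d ^ 2 * Dn + F) * ρ ^ β / (1 - (2 : ℝ) ^ (-β)) + 4 * U / ρ ^ 2
          ≤ κ * (c₀ * d ^ 2 + 1) * (Dn + F) * ρ ^ β / (1 - (2 : ℝ) ^ (-β)) + 4 * U / ρ ^ 2 := by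
            gcongr
        _ = (κ * (c₀ * d ^ 2 + 1) * ρ ^ β / (1 - (2 : ℝ) ^ (-β))) * (Dn + F) + 4 * U / ρ ^ 2 := by
            ring
        _ ≤ 1 / 2 * (Dn + F) + 4 * U / ρ ^ 2 := by gcongr
        _ = E + D / 2 ^ (n + 1) := by simp only [Dn, E, pow_succ]; ring
  have hlim : Filter.Tendsto (fun n : ℕ => κ * (c₀ * d ^ 2 * (E + D / 2 ^ n) + F) * ‖h‖ ^ (2 + β))
      Filter.atTop (nhds (κ * (c₀ * d ^ 2 * (E + 0) + F) * ‖h‖ ^ (2 + β))) := by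
    have h1 : Filter.Tendsto (fun n : ℕ => D / 2 ^ n) Filter.atTop (nhds 0) := by
      have := (tendsto_pow_atTop_nhds_zero_of_lt_one (r := (2 : ℝ)⁻¹) (by norm_num)
        (by norm_num)).const_mul D
      simpa [div_eq_mul_inv] using this
    exact ((((h1.const_add E).const_mul _).add_const F).const_mul κ).mul_const _
  rw [add_zero] at hlim
  exact ge_of_tendsto' hlim fun n => abs_fwdDiff_three_le hβ hc₀ hα ha hder hu0 hcont hU hV0 hV
    (by positivity) hF (hn n) ht x h

/-- Properties that hold for almost every time hold at times arbitrarily close to a given one. -/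
theorem exists_mem_Icc_of_ae (hT : 0 < T) {P : ℝ → Prop}
    (hP : ∀ᵐ t ∂(volume.restrict (Icc 0 T)), P t) {t : ℝ} (ht : t ∈ Icc 0 T) {δ : ℝ} (hδ : 0 < δ) :
    ∃ s ∈ Icc 0 T, P s ∧ |t - s| ≤ δ := by
  obtain ⟨p, q, hpq, hsub⟩ : ∃ p q, p < q ∧ Icc p q ⊆ Icc 0 T ∩ Icc (t - δ) (t + δ) := by
    refine ⟨max 0 (t - δ), min T (t + δ), ?_, fun s hs => ?_⟩
    · simp only [lt_min_iff, max_lt_iff]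
      exact ⟨⟨hT, by linarith [ht.2]⟩, by linarith [ht.1], by linarith⟩
    · have h1 := max_le_iff.1 hs.1
      have h2 := le_min_iff.1 hs.2
      exact ⟨⟨h1.1, h2.1⟩, h1.2, h2.2⟩
  have hP' := ae_restrict_of_ae_restrict_of_subset (hsub.trans inter_subset_left) hP
  have hne : (ae (volume.restrict (Icc p q))).NeBot := by
    rw [ae_restrict_neBot, Real.volume_Icc]
    simpa using hpq
  obtain ⟨s, hs, hsI⟩ := (hP'.and (ae_restrict_mem measurableSet_Icc)).exists
  have h1 := hsub hsI
  exact ⟨s, h1.1, hs, abs_le.2 ⟨by linarith [h1.2.2], by linarith [h1.2.1]⟩⟩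

theorem IsTimeDerivative.forall_continuous_and_le (hT : 0 < T) (h : IsTimeDerivative T u v)
    {U V : ℝ} (hV0 : 0 ≤ V) (hV : ∀ᵐ t ∂(volume.restrict (Icc 0 T)), ∀ x, |v t x| ≤ V)
    (hu : ∀ᵐ t ∂(volume.restrict (Icc 0 T)), Continuous (u t) ∧ ∀ x, |u t x| ≤ U)
    {t : ℝ} (ht : t ∈ Icc 0 T) : Continuous (u t) ∧ ∀ x, |u t x| ≤ U := by
  have happrox (δ : ℝ) (hδ : 0 < δ) : ∃ g : RSpace d → ℝ, (Continuous g ∧ ∀ x, |g x| ≤ U) ∧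
      ∀ x, |u t x - g x| ≤ δ := by
    obtain ⟨s, hs, hP, hst⟩ := exists_mem_Icc_of_ae hT hu ht
      (show 0 < δ / (V + 1) by positivity)
    refine ⟨u s, hP, fun x => (h.abs_sub_le hV hs ht x).trans ?_⟩
    calc V * |t - s| ≤ (V + 1) * (δ / (V + 1)) := by gcongr; linarith
      _ = δ := by field_simp
  refine ⟨continuous_of_uniform_approx_of_continuous (fun s hs => ?_), fun x => ?_⟩
  · obtain ⟨δ, hδ, hδs⟩ := Metric.mem_uniformity_dist.1 hs
    obtain ⟨g, hg, hgu⟩ := happrox (δ / 2) (half_pos hδ)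
    exact ⟨g, hg.1, fun x => hδs (by rw [Real.dist_eq]; linarith [hgu x])⟩
  · refine le_of_forall_pos_le_add fun δ hδ => ?_
    obtain ⟨g, hg, hgu⟩ := happrox δ hδ
    have h1 := abs_sub_abs_le_abs_sub (u t x) (g x)
    linarith [hgu x, hg.2 x]

end

section

variable {d : ℕ}

theorem abs_le_of_zygmundENorm_le {β F : ℝ} {g : RSpace d → ℝ} (hF : 0 ≤ F)
    (h : zygmundENorm β g ≤ ENNReal.ofReal F) (x : RSpace d) : |g x| ≤ F := by
  have h1 : ‖g x‖ₑ ≤ ENNReal.ofReal F :=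
    (le_iSup (fun x => ‖g x‖ₑ) x).trans (le_self_add.trans h)
  rwa [← ofReal_norm, ENNReal.ofReal_le_ofReal_iff hF] at h1

theorem abs_sub_le_of_zygmundENorm_le {β F : ℝ} (hβ : β ∈ Ioo (0 : ℝ) 1) {g : RSpace d → ℝ}
    (hF : 0 ≤ F) (h : zygmundENorm β g ≤ ENNReal.ofReal F) (x y : RSpace d) :
    |g x - g y| ≤ F * ‖x - y‖ ^ β := by
  rcases eq_or_ne x y with rfl | hxy
  · simp [Real.zero_rpow hβ.1.ne']
  have hne : x - y ≠ 0 := sub_ne_zero.2 hxy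
  have hpos : 0 < ‖x - y‖ := norm_pos_iff.2 hne
  have hceil : ⌈β⌉₊ = 1 := by
    rw [Nat.ceil_eq_iff one_ne_zero]
    simpa using ⟨hβ.1, hβ.2.le⟩
  have h1 : ‖g x - g y‖ₑ / ‖x - y‖ₑ ^ β ≤ ENNReal.ofReal F := by
    refine le_trans ?_ (le_add_self.trans h)
    refine le_trans ?_ (le_iSup₂ (f := fun (h : RSpace d) (_ : h ≠ 0) =>
      (⨆ x, ‖(fwdDiff h)^[⌈β⌉₊] g x‖ₑ) / ‖h‖ₑ ^ β) (x - y) hne)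
    gcongr
    refine le_trans (le_of_eq ?_) (le_iSup _ y)
    rw [hceil, Function.iterate_one, fwdDiff, add_sub_cancel]
  rw [← ofReal_norm, ← ofReal_norm, ENNReal.ofReal_rpow_of_pos hpos,
    ENNReal.div_le_iff (by simpa using Real.rpow_pos_of_pos hpos β) ENNReal.ofReal_ne_top,
    ← ENNReal.ofReal_mul hF, ENNReal.ofReal_le_ofReal_iff (by positivity)] at h1
  exact h1

theorem zygmundENorm_le {s C : ℝ} {m : ℕ} (hm : ⌈s⌉₊ = m) {U : ℝ} {g : RSpace d → ℝ}
    (hU0 : 0 ≤ U) (hC : 0 ≤ C) (hU : ∀ x, |g x| ≤ U)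
    (hg : ∀ x h, |(fwdDiff h)^[m] g x| ≤ C * ‖h‖ ^ s) :
    zygmundENorm s g ≤ ENNReal.ofReal (U + C) := by
  rw [ENNReal.ofReal_add hU0 hC, zygmundENorm, hm]
  refine add_le_add (iSup_le fun x => ?_) (iSup₂_le fun h hh => ?_)
  · rw [← ofReal_norm]; exact ENNReal.ofReal_le_ofReal (hU x)
  · have hpos : 0 < ‖h‖ := norm_pos_iff.2 hh
    rw [← ofReal_norm h, ENNReal.ofReal_rpow_of_pos hpos,
      ENNReal.div_le_iff (by simpa using Real.rpow_pos_of_pos hpos s) ENNReal.ofReal_ne_top,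
      ← ENNReal.ofReal_mul hC]
    refine iSup_le fun x => ?_
    rw [← ofReal_norm]; exact ENNReal.ofReal_le_ofReal (hg x h)

theorem abs_hess_le_of_iteratedFDeriv {g : RSpace d → ℝ} {D : ℝ} {x : RSpace d}
    (h : ‖iteratedFDeriv ℝ 2 g x‖ ≤ D) (b b' : RSpace d) : |hess g x b b'| ≤ D * ‖b‖ * ‖b'‖ := by
  have h1 := (iteratedFDeriv ℝ 2 g x).le_opNorm ![b, b']
  rw [iteratedFDeriv_two_apply] at h1
  simp only [Fin.prod_univ_two, Matrix.cons_val_zero, Matrix.cons_val_one] at h1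
  rw [mul_assoc]
  exact h1.trans (by gcongr)

theorem abs_sum_elliptic_mul_le {A : Matrix (Fin d) (Fin d) ℝ} {c₀ : ℝ} (hc₀ : 0 < c₀)
    (hA : A.IsSymm)
    (hell : ∀ ξ : RSpace d, c₀⁻¹ * ‖ξ‖ ^ 2 ≤ ∑ i, ∑ j, A i j * ξ i * ξ j ∧
      ∑ i, ∑ j, A i j * ξ i * ξ j ≤ c₀ * ‖ξ‖ ^ 2)
    (B : RSpace d →L[ℝ] RSpace d →L[ℝ] ℝ) {D : ℝ} (hD : 0 ≤ D)
    (hB : ∀ b, |B b b| ≤ D * ‖b‖ ^ 2) :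
    |∑ i, ∑ j, A i j * B (EuclideanSpace.single i 1) (EuclideanSpace.single j 1)| ≤
      c₀⁻¹ * D + c₀ * d * D := by
  rcases isEmpty_or_nonempty (Fin d) with hd | ⟨⟨i₀⟩⟩
  · simp only [Finset.univ_eq_empty, Finset.sum_empty, abs_zero]; positivity
  have he : ‖(EuclideanSpace.single i₀ 1 : RSpace d)‖ = 1 := by simp
  have h1 := sum_elliptic_mul_le hc₀ hA hell B hD (fun b => (abs_le.1 (hB b)).2) he
    (μ := D) (by simpa [he] using (abs_le.1 (hB (EuclideanSpace.single i₀ 1))).2)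
  have h2 := sum_elliptic_mul_le hc₀ hA hell (-B) hD
    (fun b => by simpa using neg_le.1 (abs_le.1 (hB b)).1) he
    (μ := D) (by simpa [he] using neg_le.1 (abs_le.1 (hB (EuclideanSpace.single i₀ 1))).1)
  simp only [neg_apply, mul_neg, Finset.sum_neg_distrib] at h2
  exact abs_le.2 ⟨by linarith, h1⟩

theorem continuous_of_abs_sub_le_rpow {C β : ℝ} (hβ : 0 < β) {g : RSpace d → ℝ}
    (h : ∀ x y, |g x - g y| ≤ C * ‖x - y‖ ^ β) : Continuous g := by
  refine continuous_iff_continuousAt.2 fun x => ?_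
  rw [ContinuousAt, tendsto_iff_norm_sub_tendsto_zero]
  have h1 : Filter.Tendsto (fun y => C * ‖y - x‖ ^ β) (nhds x) (nhds (C * ‖x - x‖ ^ β)) :=
    (((Real.continuous_rpow_const hβ.le).comp
      (continuous_id.sub continuous_const).norm).const_mul C).tendsto x
  rw [sub_self, norm_zero, Real.zero_rpow hβ.ne', mul_zero] at h1
  exact squeeze_zero (fun _ => norm_nonneg _) (fun y => h y x) h1

theorem IsHolderElliptic.continuous {c₀ β : ℝ} (hβ : 0 < β)
    {a : ℝ → RSpace d → Matrix (Fin d) (Fin d) ℝ} (ha : IsHolderElliptic c₀ β a) {t : ℝ}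
    (ht : 0 ≤ t) (i j : Fin d) : Continuous fun x => a t x i j :=
  continuous_of_abs_sub_le_rpow hβ fun x y => ha.abs_sub_le ht x y i j

end

end

theorem theorem3p2 (d : ℕ) (β c₀ : ℝ) (hβ : β ∈ Set.Ioo (0 : ℝ) 1) (hc₀ : 1 ≤ c₀) :
    ∃ C : ℝ≥0, ∀ (φ : LPCutoff d) (a : ℝ → RSpace d → Matrix (Fin d) (Fin d) ℝ),
      IsHolderElliptic c₀ β a →
      ∀ (T : ℝ), 0 < T → ∀ (u v f : ℝ → RSpace d → ℝ),
        MemLinftyBesov φ T (2 + β) u →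
        IsTimeDerivative T u v →
        MemLinftyBesov φ T β v →
        (∀ x, u 0 x = 0) →
        (∀ᵐ p ∂(timeSpaceMeasure d T),
          v p.1 p.2 =
            ∑ i, ∑ j, a p.1 p.2 i j * secondPartial i j (u p.1) p.2 + f p.1 p.2) →
        LinftyZygmundENorm T (2 + β) u ≤
          C * (LinftyZygmundENorm T β f + LinftyENorm T u) := by
  have hc : 0 < c₀ := one_pos.trans_le hc₀
  have hβ0 := hβ.1
  set κ : ℝ := 48 * c₀ / ((2 + β) / 3 * (1 - (2 + β) / 3))
  have hκ : 0 ≤ κ := by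
    have : 0 < 1 - (2 + β) / 3 := by linarith [hβ.2]
    positivity
  obtain ⟨ρ, hρ, hρβ⟩ : ∃ ρ : ℝ, 0 < ρ ∧
      κ * (c₀ * d ^ 2 + 1) * ρ ^ β / (1 - (2 : ℝ) ^ (-β)) ≤ 1 / 2 := by
    have hlim : Filter.Tendsto (fun ρ : ℝ => κ * (c₀ * d ^ 2 + 1) * ρ ^ β / (1 - (2 : ℝ) ^ (-β)))
        (nhdsWithin 0 (Ioi 0))
        (nhds (κ * (c₀ * d ^ 2 + 1) * 0 ^ β / (1 - (2 : ℝ) ^ (-β)))) :=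
      tendsto_nhdsWithin_of_tendsto_nhds (Continuous.tendsto ((continuous_const.mul
        (Real.continuous_rpow_const hβ0.le)).div_const _) 0)
    rw [Real.zero_rpow hβ0.ne', mul_zero, zero_div] at hlim
    obtain ⟨ρ, h1, h2⟩ := ((hlim.eventually (eventually_le_nhds one_half_pos)).and
      self_mem_nhdsWithin).exists
    exact ⟨ρ, h2, h1⟩
  set C : ℝ := 1 + κ * ((c₀ * d ^ 2 + 1) * (1 + 8 / ρ ^ 2))
  have hC : 0 < C := by positivity
  refine ⟨C.toNNReal, fun φ a ha T hT u v f hu hder hv hu0 heq => ?_⟩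
  have hCne : (C.toNNReal : ℝ≥0∞) ≠ 0 := by simpa using hC
  rcases eq_or_ne (LinftyZygmundENorm T β f) ∞ with hf | hf
  · rw [hf, top_add, ENNReal.mul_top hCne]; exact le_top
  rcases eq_or_ne (LinftyENorm T u) ∞ with hU | hU
  · rw [hU, add_top, ENNReal.mul_top hCne]; exact le_top
  set F : ℝ := (LinftyZygmundENorm T β f).toReal
  set U : ℝ := (LinftyENorm T u).toReal
  have hF0 : 0 ≤ F := ENNReal.toReal_nonneg
  have hU0 : 0 ≤ U := ENNReal.toReal_nonneg
  have hFeq : LinftyZygmundENorm T β f = ENNReal.ofReal F := (ENNReal.ofReal_toReal hf).symm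
  have hUeq : LinftyENorm T u = ENNReal.ofReal U := (ENNReal.ofReal_toReal hU).symm
  have hfae : ∀ᵐ t ∂(volume.restrict (Icc 0 T)), zygmundENorm β (f t) ≤ ENNReal.ofReal F := by
    rw [← hFeq]; exact ENNReal.ae_le_essSup _
  obtain ⟨-, M, hM⟩ := hu
  obtain ⟨-, _, hvc⟩ := hv
  have huae : ∀ᵐ t ∂(volume.restrict (Icc 0 T)), Continuous (u t) ∧ ∀ x, |u t x| ≤ U := by
    have h1 : ∀ᵐ p ∂(timeSpaceMeasure d T), |u p.1 p.2| ≤ U := by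
      have h2 : ∀ᵐ p ∂(timeSpaceMeasure d T), ‖u p.1 p.2‖ₑ ≤ LinftyENorm T u :=
        ae_le_eLpNormEssSup
      filter_upwards [h2] with p hp
      rwa [hUeq, ← ofReal_norm, ENNReal.ofReal_le_ofReal_iff hU0] at hp
    filter_upwards [Measure.ae_ae_of_ae_prod h1, hM] with t ht hMt
    refine ⟨hMt.1, fun x => ?_⟩
    have hcl : IsClosed {x | |u t x| ≤ U} := isClosed_le hMt.1.abs continuous_const
    have hd : Dense {x | |u t x| ≤ U} := Measure.dense_of_ae ht
    have := hd.closure_eq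
    rw [hcl.closure_eq] at this
    exact this.ge (mem_univ x)
  obtain ⟨D₁, N, hreg₀⟩ := φ.besov_regularity hβ M
  set D : ℝ := max D₁ 0
  have hD : 0 ≤ D := le_max_right _ _
  have hreg₁ : ∀ᵐ t ∂(volume.restrict (Icc 0 T)), ContDiff ℝ 2 (u t) ∧
      (∀ x, ‖iteratedFDeriv ℝ 2 (u t) x‖ ≤ D) ∧
      ∀ x h, |(fwdDiff h)^[3] (u t) x| ≤ N * ‖h‖ ^ (2 + β / 2) := by
    filter_upwards [huae, hM] with t h1 h2
    obtain ⟨hc, G, hG1, hG2⟩ := h2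
    obtain ⟨r1, r2, r3⟩ := hreg₀ (u t) U G hc h1.2 hG1 hG2
    exact ⟨r1, fun x => (r2 x).trans (le_max_left _ _), r3⟩
  have hreg : ∀ᵐ t ∂(volume.restrict (Icc 0 T)),
      RegularSlice β (β / 2) D F N (a t) (u t) (v t) (f t) := by
    filter_upwards [hreg₁, hfae, hvc, Measure.ae_ae_of_ae_prod heq,
      ae_restrict_mem measurableSet_Icc] with t ⟨r1, r2, r3⟩ hft hvt hpde htI
    have hhol := abs_sub_le_of_zygmundENorm_le hβ hF0 hft
    refine ⟨r1, fun x i j => ?_, r3, hhol, fun x => ?_⟩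
    · simpa using abs_hess_le_of_iteratedFDeriv (r2 x) (EuclideanSpace.single i 1)
        (EuclideanSpace.single j 1)
    · simp only [secondPartial_eq_hess r1] at hpde
      have hhc : Continuous (hess (u t)) :=
        (r1.fderiv_right (m := 1) (by norm_num)).continuous_fderiv (by norm_num)
      have hcr : Continuous fun x => ∑ i, ∑ j, a t x i j *
          hess (u t) x (EuclideanSpace.single i 1) (EuclideanSpace.single j 1) + f t x := by
        refine Continuous.add (continuous_finsetSum _ fun i _ => continuous_finsetSum _ fun j _ =>
          (ha.continuous hβ0 htI.1 i j).mul ?_) (continuous_of_abs_sub_le_rpow hβ0 hhol)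
        exact (hhc.clm_apply continuous_const).clm_apply continuous_const
      exact congrFun ((hvt.1.ae_eq_iff_eq volume hcr).1 hpde) x
  set V : ℝ := c₀⁻¹ * D + c₀ * d * D + F
  have hV0 : 0 ≤ V := by positivity
  have hV : ∀ᵐ t ∂(volume.restrict (Icc 0 T)), ∀ x, |v t x| ≤ V := by
    filter_upwards [hreg, hreg₁, hfae, ae_restrict_mem measurableSet_Icc] with t ht hr hft htI x
    rw [ht.eq]
    refine (abs_add_le _ _).trans (add_le_add (abs_sum_elliptic_mul_le hc (ha.symm t htI.1 x)
      (ha.elliptic t htI.1 x) _ hD fun b => ?_) (abs_le_of_zygmundENorm_le hF0 hft x))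
    exact (abs_hess_le_of_iteratedFDeriv (hr.2.1 x) b b).trans (le_of_eq (by ring))
  have hall {t : ℝ} (ht : t ∈ Icc 0 T) := hder.forall_continuous_and_le hT hV0 hV huae ht
  have hceil : ⌈2 + β⌉₊ = 3 := by
    rw [Nat.ceil_eq_iff (by norm_num)]
    constructor
    · norm_num; linarith
    · push_cast; linarith [hβ.2]
  have hE0 : 0 ≤ κ * (c₀ * d ^ 2 * (F + 8 * U / ρ ^ 2) + F) := by positivity
  rw [hFeq, hUeq, ← ENNReal.ofReal_add hF0 hU0,
    show (C.toNNReal : ℝ≥0∞) = ENNReal.ofReal C from rfl, ← ENNReal.ofReal_mul hC.le]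
  refine essSup_le_of_ae_le _ ?_
  filter_upwards [ae_restrict_mem measurableSet_Icc] with t ht
  refine (zygmundENorm_le hceil hU0 hE0 (hall ht).2
    (abs_fwdDiff_three_le_of_regularSlice hβ hc (half_pos hβ0) ha hder hu0 (fun t ht => (hall ht).1)
      hU0 (fun t ht => (hall ht).2) hV0 hV hD hF0 hreg hρ hρβ ht)).trans ?_
  refine ENNReal.ofReal_le_ofReal ?_
  have h1 : c₀ * d ^ 2 * (F + 8 * U / ρ ^ 2) + F ≤
      (c₀ * d ^ 2 + 1) * (1 + 8 / ρ ^ 2) * (F + U) := by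
    have e1 : (c₀ * d ^ 2 + 1) * (1 + 8 / ρ ^ 2) * (F + U) =
        (c₀ * d ^ 2 * (F + 8 * U / ρ ^ 2) + F) +
        (c₀ * d ^ 2 * U + U + 8 / ρ ^ 2 * (c₀ * d ^ 2 * F + F + U)) := by ring
    rw [e1]
    exact le_add_of_nonneg_right (by positivity)
  have h2 := mul_le_mul_of_nonneg_left h1 hκ
  simp only [C]
  linarith
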